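/- Let $K$ be a field of arbitrary characteristic, let $A=K\langle x_1,\dots,x_k\rangle$ be the free associative algebra, and let $F$ be the free group on $x_1,\dots,x_k$, equipped with a total order that is invariant under left and right multiplication and satisfies $a>b$ whenever the total degree (exponent sum) of $a$ exceeds that of $b$. For nonzero $f\in A$ let $\deg f$ be its total degree and let its leading monomial $v(f)$ be the monomial in the support of $f$ that is greatest in this order. For $P\in K\langle x,y\rangle\setminus\{0\}$ let $w_{a,b}(P)$ be the maximum of $a\deg_x(z)+b\deg_y(z)$ over the monomials $z$ in the support of $P$. Two elements $a,b$ of a $K$-algebra are called algebraically independent if the homomorphism from $K\langle x,y\rangle$ sending $x\mapsto a$, $y\mapsto b$ is injective, and algebraically dependent otherwise. Write $[f,g]=fg-gf$. (1) Suppose that $f,g\in A$ are algebraically independent, that $v(f)$ and $v(g)$ are algebraically dependent, and that $\deg f\nmid\deg g$ and $\deg g\nmid\deg f$. Then for every $P\in K\langle x,y\rangle\setminus K$, $$\deg P(f,g)\;\ge\; w_{\deg f,\deg g}(P)\cdot\frac{\deg [f,g]}{\deg f+\deg g}.$$ (2) The bound is sharp: let $x_i\ne x_j$ be two of the generators, let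 $n,m$ be natural numbers with $n\nmid m$ and $m\nmid n$, and let $r\ge1$. Then $f=x_i^n$, $g=x_i^m+x_j$ satisfy all the hypotheses of (1), and equality holds in (1) for the nonconstant polynomial $P=[x,y]^r$. -/

import Mathlib

namespace FreeDeg

/-- The monomials, as words in the generators, occurring in `f` with nonzero coefficient. -/
noncomputable def supp {K X : Type*} [Field K] (f : FreeAlgebra K X) : Finset (FreeMonoid X) :=
  (FreeAlgebra.equivMonoidAlgebraFreeMonoid f).coeff.support

/-- The weighted degree of an element of the free algebra: the maximum, over the monomials in the
support, of the sum of the weights of the letters (the value at `0` is `0`). -/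
noncomputable def wdeg {K X : Type*} [Field K] (w : X → ℕ) (f : FreeAlgebra K X) : ℕ :=
  (supp f).sup fun u => (u.toList.map w).sum

/-- The total degree. -/
noncomputable def deg {K X : Type*} [Field K] (f : FreeAlgebra K X) : ℕ :=
  wdeg (fun _ => 1) f

/-- A word regarded as an element of the free algebra. -/
noncomputable def monomial (K : Type*) {X : Type*} [Field K] (u : FreeMonoid X) :
    FreeAlgebra K X :=
  FreeMonoid.lift (FreeAlgebra.ι K) u

/-- Substitution `P(a, b)` of two elements into a noncommutative polynomial in two variables. -/
noncomputable def eval₂ {K A : Type*} [Field K] [Ring A] [Algebra K A] (a b : A)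
    (P : FreeAlgebra K (Fin 2)) : A :=
  FreeAlgebra.lift K ![a, b] P

/-- `a` and `b` are algebraically independent over `K`: they freely generate a free associative
subalgebra of rank two. -/
def AlgIndep (K : Type*) {A : Type*} [Field K] [Ring A] [Algebra K A] (a b : A) : Prop :=
  Function.Injective (eval₂ a b : FreeAlgebra K (Fin 2) → A)

/-- The total degree on the free group: the homomorphism to `ℤ` taking each generator to `1`. -/
def groupDeg {X : Type*} (a : FreeGroup X) : ℤ :=
  Multiplicative.toAdd (FreeGroup.lift (fun _ : X => Multiplicative.ofAdd (1 : ℤ)) a)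

/-- The given total order of the free group is a group order (invariant under multiplication from
both sides) that extends the partial order by total degree. -/
structure IsDegreeGroupOrder (X : Type*) [LinearOrder (FreeGroup X)] : Prop where
  mul_lt_mul_left : ∀ a b c : FreeGroup X, b < a → c * b < c * a
  mul_lt_mul_right : ∀ a b c : FreeGroup X, b < a → b * c < a * c
  lt_of_groupDeg_lt : ∀ a b : FreeGroup X, groupDeg b < groupDeg a → b < a

/-- A word regarded as an element of the free group. -/
def toFreeGroup {X : Type*} (u : FreeMonoid X) : FreeGroup X :=
  FreeMonoid.lift FreeGroup.of u

/-- `u` is the leading monomial of `f`: the greatest monomial in its support with respect to the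
order of the free group. -/
def IsLeadingMonomial {K X : Type*} [Field K] [LinearOrder (FreeGroup X)]
    (f : FreeAlgebra K X) (u : FreeMonoid X) : Prop :=
  u ∈ supp f ∧ ∀ v ∈ supp f, toFreeGroup v ≤ toFreeGroup u

/-- `f` and `g` are algebraically independent, their leading monomials are algebraically dependent,
and neither of the degrees of `f` and `g` divides the other. -/
structure Admissible {K X : Type*} [Field K] [LinearOrder (FreeGroup X)]
    (f g : FreeAlgebra K X) : Prop where
  algIndep : AlgIndep K f g
  leading_dependent : ∃ u v : FreeMonoid X, IsLeadingMonomial f u ∧ IsLeadingMonomial g v ∧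
    ¬ AlgIndep K (monomial K u) (monomial K v)
  not_dvd : ¬ deg f ∣ deg g
  not_dvd' : ¬ deg g ∣ deg f

end FreeDeg

/-!
The estimate is proved in the Malcev–Neumann ring of the free group, that is, in the ring of
series over the free group with well-ordered supports, which contains the free algebra. The order
of the free group is reversed, so that leading terms are first terms, of largest degree. Leading
exponents are multiplicative, and degrees of elements of the free algebra are degrees of leading
exponents.

Let `f` have the smaller degree, let `a` be its leading exponent and `C` the centralizer of `a`,
which is cyclic. A series `1 + t` with all exponents of `t` beyond `1` conjugates `f` to a series
`φ` supported in `C` (`exists_conj_centralizer`): the equation for `t` is solved exponent by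
exponent, as a fixed point (`exists_fixedPoint`). The same series conjugates `g` to `γ + η`, with
`γ` supported in `C` and `η` off `C`. Conjugation changes neither leading exponents nor the
degrees of values of polynomials, and `φ` commutes with `γ`, so `deg [f, g] = deg a + deg h` for
the leading exponent `h` of `η`; in particular `η ≠ 0`, since `f` and `g` do not commute.

As `h` is not in `C`, and two elements of a free group that do not commute are free generators of
the subgroup they generate, the first factor of a product `c₀ * h * c₁ * h * ⋯ * cⱼ` with all `cᵢ`
in `C` is determined by the product (`AltWord.left_unique`). Now expand `P(φ, γ + η)` according to
the first occurrence of `η`. It is the sum of `P(φ, γ)`, supported in `C`, and of terms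
`c * η * Q`, one for each `c` in `C`, where `Q` is the value at `(φ, γ + η)` of a polynomial in shorter
words, the cofactor of `P` at `c`. By induction the leading exponents of all these summands are
distinct, so nothing cancels (`lead_polyEval`).

It remains to find a summand of large degree (`DegreeData.weight_le_lead`). Among the words of `P`
of maximal weight, where `x` stands for `f` and `y` for `g`, those with the most letters `y` show
that `P(φ, γ)` or a suitable cofactor has a term of maximal weight; that `deg f` does not divide
`deg g` is used for words that start with `y`. Each passage to a cofactor loses `deg g - deg h` in
degree and, unless this is zero, at least `deg f + deg g` in weight. Hence a polynomial of weight
`w` has degree at least `w - j * (deg g - deg h)` for some `j` with `j * (deg f + deg g) ≤ w`,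
which is the estimate.

For the sharpness, `x ^ n` and `x ^ m + y` are already of the form `φ`, `γ + η`, so the same
expansion shows that they are algebraically independent, and the degrees of the powers of the
commutator are read off from homogeneity.
-/

namespace FreeDeg

/-! ### Centralizers and free subgroups of free groups -/

/-- A functional and injective relation on a finite type is contained in the graph of a
permutation. -/
theorem exists_perm_of_partial {β : Type*} [Finite β] (R : β → β → Prop)
    (hfun : ∀ p q q', R p q → R p q' → q = q') (hinj : ∀ p p' q, R p q → R p' q → p = p') :
    ∃ σ : Equiv.Perm β, ∀ p q, R p q → σ p = q := by
  classical
  cases nonempty_fintype β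
  choose F hF using fun p : {p // ∃ q, R p q} => p.2
  let e : {p // ∃ q, R p q} ≃ {q // ∃ p, R p q} :=
    Equiv.ofBijective (fun p => ⟨F p, p.1, hF p⟩) <| by
      refine ⟨fun p p' h => Subtype.ext ?_, fun q => ?_⟩
      · have h' : F p = F p' := congrArg Subtype.val h
        exact hinj _ _ _ (hF p) (h' ▸ hF p')
      · obtain ⟨q, p, hp⟩ := q
        exact ⟨⟨p, q, hp⟩, Subtype.ext (hfun _ _ _ (hF _) hp)⟩
  refine ⟨e.extendSubtype, fun p q hpq => ?_⟩
  rw [Equiv.extendSubtype_apply_of_mem e p ⟨q, hpq⟩]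
  exact hfun _ _ _ (hF ⟨p, q, hpq⟩) hpq

/-- Free groups are residually finite: the letters of a reduced word of length `n` act as partial
injections on `n + 1` points so that the word moves the last point to the first one. -/
theorem exists_perm_hom_ne_one {α : Type*} (g : FreeGroup α) (hg : g ≠ 1) :
    ∃ (n : ℕ) (ρ : FreeGroup α →* Equiv.Perm (Fin n)), ρ g ≠ 1 := by
  classical
  set L := g.toWord with hL
  have hred : FreeGroup.IsReduced L := FreeGroup.isReduced_toWord
  have hne : L ≠ [] := fun h => hg (FreeGroup.toWord_eq_nil_iff.1 h)
  have hstep : ∀ i x (b b' : Bool), L[i]? = some (x, b) → L[i + 1]? = some (x, b') → b = b' := by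
    intro i x b b' h1 h2
    obtain ⟨h1l, h1⟩ := List.getElem?_eq_some_iff.1 h1
    obtain ⟨h2l, h2⟩ := List.getElem?_eq_some_iff.1 h2
    have := List.isChain_iff_getElem.1 hred i h2l
    rw [h1, h2] at this
    exact this rfl
  have hσ : ∀ x : α, ∃ σ : Equiv.Perm (Fin (L.length + 1)), ∀ p q : Fin (L.length + 1),
      ((L[q.1]? = some (x, true) ∧ p.1 = q.1 + 1) ∨
        (L[p.1]? = some (x, false) ∧ q.1 = p.1 + 1)) → σ p = q := by
    intro x
    refine exists_perm_of_partial _ ?_ ?_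
    · rintro p q q' (⟨h1, h2⟩ | ⟨h1, h2⟩) (⟨h3, h4⟩ | ⟨h3, h4⟩)
      · exact Fin.ext (by omega)
      · rw [h2] at h3
        exact absurd (hstep _ _ _ _ h1 h3) (by simp)
      · rw [h4] at h1
        exact absurd (hstep _ _ _ _ h3 h1) (by simp)
      · exact Fin.ext (by omega)
    · rintro p q q' (⟨h1, h2⟩ | ⟨h1, h2⟩) (⟨h3, h4⟩ | ⟨h3, h4⟩)
      · exact Fin.ext (by omega)
      · rw [h4] at h1
        exact absurd (hstep _ _ _ _ h3 h1) (by simp)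
      · rw [h2] at h3
        exact absurd (hstep _ _ _ _ h1 h3) (by simp)
      · exact Fin.ext (by omega)
  choose σ hσ using hσ
  refine ⟨_, FreeGroup.lift σ, fun h1 => ?_⟩
  -- a suffix of the word takes the last point to the position where the suffix starts
  have key : ∀ M N : List (α × Bool), L = N ++ M →
      ((FreeGroup.lift σ (FreeGroup.mk M)) (Fin.last L.length)).1 = N.length := by
    intro M
    induction M with
    | nil => intro N h; simp [h]
    | cons m M ih =>
      intro N h
      have h2 := ih (N ++ [m]) (by simp [h])
      have hm : L[N.length]? = some m := by simp [h]
      have hlt : N.length < L.length + 1 := by simp [h]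
      rw [FreeGroup.lift_mk] at h2 ⊢
      rw [List.map_cons, List.prod_cons, Equiv.Perm.mul_apply]
      set p := (List.map (fun x => bif x.2 then σ x.1 else (σ x.1)⁻¹) M).prod (Fin.last L.length)
      obtain ⟨x, b⟩ := m
      have h2' : p.1 = N.length + 1 := by simpa using h2
      cases b
      · have := hσ x ⟨N.length, hlt⟩ p (Or.inr ⟨hm, h2'⟩)
        simp only [cond_false]
        rw [← this]; simp
      · have := hσ x p ⟨N.length, hlt⟩ (Or.inl ⟨hm, h2'⟩)
        simp only [cond_true]
        rw [this]
  have := key L [] rfl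
  have hmk : FreeGroup.mk L = g := FreeGroup.mk_toWord
  rw [hmk, h1] at this
  simp at this
  exact hne this

/-- Free groups of finite rank are Hopfian. -/
theorem injective_of_surjective_endo {α : Type*} [Finite α] (π : FreeGroup α →* FreeGroup α)
    (hπ : Function.Surjective π) : Function.Injective π := by
  rw [injective_iff_map_eq_one]
  intro w hw
  by_contra hne
  obtain ⟨n, ρ, hρ⟩ := exists_perm_hom_ne_one w hne
  have : Finite (FreeGroup α →* Equiv.Perm (Fin n)) := Finite.of_equiv _ FreeGroup.lift
  -- composition with `π` permutes the finitely many homomorphisms to a finite group, so that a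
  -- homomorphism detecting `w` factors through `π`
  have hinj : Function.Injective
      (fun χ : FreeGroup α →* Equiv.Perm (Fin n) => χ.comp π) := fun χ χ' h =>
    (MonoidHom.cancel_right hπ).1 h
  obtain ⟨χ, hχ⟩ := Finite.surjective_of_injective hinj ρ
  apply hρ
  rw [← hχ]
  simp [hw]

/-- A free group with a nontrivial central element has rank at most one. -/
theorem subsingleton_of_central {S : Type*} (a : FreeGroup S) (ha : a ≠ 1)
    (hc : ∀ g, a * g = g * a) : Subsingleton S := by
  classical
  obtain ⟨x, b, L, hL⟩ : ∃ x b L, a.toWord = (x, b) :: L := by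
    cases h : a.toWord with
    | nil => exact absurd (FreeGroup.toWord_eq_nil_iff.1 h) ha
    | cons y L => exact ⟨y.1, y.2, L, rfl⟩
  have hred : FreeGroup.IsReduced a.toWord := FreeGroup.isReduced_toWord
  suffices h : ∀ z, z = x from ⟨fun y z => (h y).trans (h z).symm⟩
  intro z
  by_contra hz
  -- a letter `z` with the sign of the last letter of `a` cancels on neither side of `a`
  obtain ⟨s, hs⟩ : ∃ s : Bool, FreeGroup.IsReduced (a.toWord ++ [(z, s)]) := by
    have hlast := List.getLast_mem (l := a.toWord) (by simp [hL])
    set l := a.toWord.getLast (by simp [hL]) with hl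
    refine ⟨l.2, ?_⟩
    unfold FreeGroup.IsReduced at hred ⊢
    refine hred.append (by simp) ?_
    intro p hp q hq hpq
    rw [List.getLast?_eq_getLast_of_ne_nil (by simp [hL])] at hp
    simp at hp hq
    rw [← hp, ← hq]
  have hs' : FreeGroup.IsReduced ((z, s) :: a.toWord) := by
    rw [hL] at hred ⊢
    exact FreeGroup.isReduced_cons_cons.2 ⟨fun h => absurd h hz, hred⟩
  have h := hc (FreeGroup.mk [(z, s)])
  have e1 : a * FreeGroup.mk [(z, s)] = FreeGroup.mk (a.toWord ++ [(z, s)]) := by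
    conv_lhs => rw [← FreeGroup.mk_toWord (x := a)]
    rw [FreeGroup.mul_mk]
  have e2 : FreeGroup.mk [(z, s)] * a = FreeGroup.mk ((z, s) :: a.toWord) := by
    conv_lhs => rw [← FreeGroup.mk_toWord (x := a)]
    rw [FreeGroup.mul_mk]; rfl
  rw [e1, e2] at h
  have h2 := congrArg FreeGroup.toWord h
  rw [FreeGroup.toWord_mk, FreeGroup.toWord_mk, hs.reduce_eq, hs'.reduce_eq, hL] at h2
  simp at h2
  exact hz h2.1.1.symm

/-- The centralizer of a nontrivial element of a free group is cyclic. -/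
theorem centralizer_eq_zpowers {α : Type*} (a : FreeGroup α) (ha : a ≠ 1) :
    ∃ u, Subgroup.centralizer {a} = Subgroup.zpowers u := by
  set C := Subgroup.centralizer {a}
  have haC : a ∈ C := Subgroup.mem_centralizer_singleton_iff.2 rfl
  let e := IsFreeGroup.toFreeGroup C
  have hS : Subsingleton (IsFreeGroup.Generators C) := by
    refine subsingleton_of_central (e ⟨a, haC⟩) ?_ ?_
    · intro h
      rw [map_eq_one_iff e e.injective] at h
      exact ha (congrArg Subtype.val h)
    · intro g
      obtain ⟨g, rfl⟩ := e.surjective g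
      rw [← map_mul, ← map_mul]
      congr 1
      exact Subtype.ext (Subgroup.mem_centralizer_singleton_iff.1 g.2).symm
  have hcyc : IsCyclic C := by
    rcases isEmpty_or_nonempty (IsFreeGroup.Generators C) with h | ⟨⟨s⟩⟩
    · have : Subsingleton C := e.toEquiv.subsingleton
      infer_instance
    · have : Unique (IsFreeGroup.Generators C) := ⟨⟨s⟩, fun t => Subsingleton.elim _ _⟩
      refine ⟨e.symm (FreeGroup.of s), fun x => ?_⟩
      change x ∈ Subgroup.zpowers (e.symm (FreeGroup.of s))
      obtain ⟨x, rfl⟩ := e.symm.surjective x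
      induction x using FreeGroup.induction_on with
      | C1 => rw [map_one]; exact one_mem _
      | of t => rw [Subsingleton.elim t s]; exact Subgroup.mem_zpowers _
      | inv_of t h => rw [map_inv]; exact inv_mem h
      | mul x y hx hy => rw [map_mul]; exact mul_mem hx hy
  obtain ⟨u, hu⟩ := hcyc
  refine ⟨u.1, le_antisymm (fun x hx => ?_) (by
    rw [Subgroup.zpowers_le]; exact u.2)⟩
  obtain ⟨n, hn⟩ := hu ⟨x, hx⟩
  exact ⟨n, congrArg Subtype.val hn⟩

/-- Two elements of a free group that do not commute are free generators of the subgroup that they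
generate. By the Nielsen–Schreier theorem this subgroup is free; homomorphisms to the group of order
two show that its rank is two, and the Hopf property does the rest. -/
theorem lift_injective_of_not_commute {α : Type*} (u h : FreeGroup α) (huh : u * h ≠ h * u) :
    Function.Injective (FreeGroup.lift ![u, h]) := by
  classical
  set H := (FreeGroup.lift ![u, h]).range with hH
  let e := IsFreeGroup.toFreeGroup H
  set S := IsFreeGroup.Generators H
  let π : FreeGroup (Fin 2) →* FreeGroup S :=
    e.toMonoidHom.comp (FreeGroup.lift ![u, h]).rangeRestrict
  have hπ : Function.Surjective π :=
    e.surjective.comp (FreeGroup.lift ![u, h]).rangeRestrict_surjective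
  let Φ : (S → Multiplicative (ZMod 2)) → (Fin 2 → Multiplicative (ZMod 2)) :=
    fun χ i => FreeGroup.lift χ (π (FreeGroup.of i))
  -- `S` has at most two elements, as the characters of order two of `FreeGroup S` embed in those of
  -- the free group on two letters
  have hΦ : Function.Injective Φ := by
    intro χ χ' hχ
    have : (FreeGroup.lift χ).comp π = (FreeGroup.lift χ').comp π :=
      FreeGroup.ext_hom _ _ fun i => congrFun hχ i
    exact FreeGroup.lift.injective ((MonoidHom.cancel_right hπ).1 this)
  have hfin : Finite (S → Multiplicative (ZMod 2)) := Finite.of_injective Φ hΦ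
  have hSfin : Finite S := by
    refine Finite.of_injective
      (fun s : S => (Pi.mulSingle s (Multiplicative.ofAdd (1 : ZMod 2)) :
        S → Multiplicative (ZMod 2))) ?_
    intro s t hst
    by_contra hne
    have := congrFun hst s
    simp [hne] at this
  cases nonempty_fintype S
  have hcard : Fintype.card S ≤ 2 := by
    have h1 := Fintype.card_le_of_injective Φ hΦ
    have h2 : Fintype.card (Multiplicative (ZMod 2)) = 2 := rfl
    rw [Fintype.card_fun, Fintype.card_fun, h2, Fintype.card_fin] at h1
    exact (Nat.pow_le_pow_iff_right (by norm_num)).1 h1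
  -- and at least two, as `u` and `h` do not commute
  have hcard2 : ¬ Fintype.card S ≤ 1 := by
    intro h1
    have : Subsingleton S := Fintype.card_le_one_iff_subsingleton.1 h1
    have hcomm : ∀ x y : FreeGroup S, x * y = y * x := by
      intro x y
      rcases isEmpty_or_nonempty S with hS | ⟨⟨s⟩⟩
      · exact Subsingleton.elim _ _
      · have : Unique S := ⟨⟨s⟩, fun t => Subsingleton.elim _ _⟩
        have hz : ∀ x : FreeGroup S, x ∈ Subgroup.zpowers (FreeGroup.of s) := by
          intro x
          induction x using FreeGroup.induction_on with
          | C1 => exact one_mem _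
          | of t => rw [Subsingleton.elim t s]; exact Subgroup.mem_zpowers _
          | inv_of t h => exact inv_mem h
          | mul x y hx hy => exact mul_mem hx hy
        obtain ⟨m, rfl⟩ := hz x
        obtain ⟨n, rfl⟩ := hz y
        exact zpow_mul_comm _ _ _
    have h2 := hcomm (π (FreeGroup.of 0)) (π (FreeGroup.of 1))
    rw [← map_mul, ← map_mul] at h2
    have h3 : FreeGroup.lift ![u, h] (FreeGroup.of 0 * FreeGroup.of 1) =
        FreeGroup.lift ![u, h] (FreeGroup.of 1 * FreeGroup.of 0) :=
      congrArg Subtype.val (e.injective h2)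
    apply huh
    simpa using h3
  let ε : S ≃ Fin 2 := Fintype.equivFinOfCardEq (by omega)
  let π' : FreeGroup (Fin 2) →* FreeGroup (Fin 2) :=
    (FreeGroup.freeGroupCongr ε).toMonoidHom.comp π
  have hπ' : Function.Injective π' :=
    injective_of_surjective_endo π' ((FreeGroup.freeGroupCongr ε).surjective.comp hπ)
  intro x y hxy
  apply hπ'
  have : (FreeGroup.lift ![u, h]).rangeRestrict x = (FreeGroup.lift ![u, h]).rangeRestrict y :=
    Subtype.ext hxy
  simp only [π', π, MonoidHom.comp_apply, this]

/-! ### Alternating words -/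

/-- The products `c₀ * h * c₁ * h * ⋯ * h * cⱼ` with all `cᵢ` in `C`. -/
inductive AltWord {G : Type*} [Group G] (C : Subgroup G) (h : G) : G → Prop
  | base {c : G} : c ∈ C → AltWord C h c
  | step {c v : G} : c ∈ C → AltWord C h v → AltWord C h (c * h * v)

/-- The reduced word of a power of a generator. -/
theorem zpow_mk_eq {α : Type*} (x : α) (i : ℤ) :
    ∃ b : Bool, FreeGroup.of x ^ i = FreeGroup.mk (List.replicate i.natAbs (x, b)) := by
  have hn : ∀ (n : ℕ) b, FreeGroup.mk [(x, b)] ^ n = FreeGroup.mk (List.replicate n (x, b)) := by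
    intro n b
    induction n with
    | zero => rfl
    | succ n ih => rw [pow_succ', ih, FreeGroup.mul_mk]; rfl
  rcases le_total 0 i with h | h
  · refine ⟨true, ?_⟩
    rw [← hn]
    conv_lhs => rw [← Int.natAbs_of_nonneg h]
    rw [zpow_natCast]; rfl
  · refine ⟨false, ?_⟩
    rw [← hn]
    have : FreeGroup.mk [(x, false)] = (FreeGroup.of x)⁻¹ := rfl
    rw [this, inv_pow, ← zpow_natCast, ← zpow_neg]
    congr 1
    omega

/-- In the free group on two letters, multiplying a word without negative occurrences of the second
letter by a power of the first one followed by the second one involves no cancellation. -/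
theorem toWord_zpow_mul_of (i : ℤ) (w : FreeGroup (Fin 2)) (hw : ((1 : Fin 2), false) ∉ w.toWord) :
    ∃ (n : ℕ) (b : Bool), FreeGroup.of (0 : Fin 2) ^ i = FreeGroup.mk (List.replicate n (0, b)) ∧
      (FreeGroup.of 0 ^ i * FreeGroup.of 1 * w).toWord =
        List.replicate n (0, b) ++ (1, true) :: w.toWord := by
  obtain ⟨b, hb⟩ := zpow_mk_eq (0 : Fin 2) i
  refine ⟨i.natAbs, b, hb, ?_⟩
  have hred : FreeGroup.IsReduced (List.replicate i.natAbs ((0 : Fin 2), b) ++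
      (1, true) :: w.toWord) := by
    refine List.IsChain.append (List.isChain_replicate_of_rel _ fun _ => rfl) ?_ ?_
    · have hr : FreeGroup.IsReduced w.toWord := FreeGroup.isReduced_toWord
      cases h : w.toWord with
      | nil => exact List.isChain_singleton _
      | cons p L =>
        rw [h] at hr hw
        refine List.isChain_cons_cons.2 ⟨fun hp => ?_, hr⟩
        obtain ⟨x, s⟩ := p
        cases s
        · simp only at hp
          subst hp
          simp at hw
        · rfl
    · intro p hp q hq hpq
      have := List.mem_of_mem_getLast? hp
      rw [List.mem_replicate] at this
      simp at hq
      rw [this.2, ← hq] at hpq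
      simp at hpq
  have he : FreeGroup.of 0 ^ i * FreeGroup.of 1 * w =
      FreeGroup.mk (List.replicate i.natAbs ((0 : Fin 2), b) ++ (1, true) :: w.toWord) := by
    conv_lhs => rw [← FreeGroup.mk_toWord (x := w), hb]
    change FreeGroup.mk _ * FreeGroup.mk _ * FreeGroup.mk _ = _
    rw [FreeGroup.mul_mk, FreeGroup.mul_mk]
    simp
  rw [he, FreeGroup.toWord_mk, hred.reduce_eq]

theorem AltWord.notMem_toWord {w : FreeGroup (Fin 2)}
    (hw : AltWord (Subgroup.zpowers (FreeGroup.of 0)) (FreeGroup.of 1) w) :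
    ((1 : Fin 2), false) ∉ w.toWord := by
  induction hw with
  | @base c hc =>
    obtain ⟨i, rfl⟩ := hc
    obtain ⟨b, hb⟩ := zpow_mk_eq (0 : Fin 2) i
    simp only
    rw [hb, FreeGroup.toWord_mk, FreeGroup.IsReduced.reduce_eq]
    · simp [List.mem_replicate]
    · exact List.isChain_replicate_of_rel _ fun _ => rfl
  | @step c v hc _ ih =>
    obtain ⟨i, rfl⟩ := hc
    obtain ⟨n, b, -, h⟩ := toWord_zpow_mul_of i v ih
    rw [h]
    simp [ih, List.mem_replicate]

/-- An alternating word over a cyclic group is the image of one in the free group on two letters. -/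
theorem AltWord.exists_lift {G : Type*} [Group G] {u h v : G}
    (hv : AltWord (Subgroup.zpowers u) h v) :
    ∃ w, AltWord (Subgroup.zpowers (FreeGroup.of (0 : Fin 2))) (FreeGroup.of 1) w ∧
      FreeGroup.lift ![u, h] w = v := by
  induction hv with
  | @base c hc =>
    obtain ⟨i, rfl⟩ := hc
    exact ⟨FreeGroup.of 0 ^ i, .base ⟨i, rfl⟩, by simp⟩
  | @step c v hc _ ih =>
    obtain ⟨i, rfl⟩ := hc
    obtain ⟨w, hw, rfl⟩ := ih
    exact ⟨FreeGroup.of 0 ^ i * FreeGroup.of 1 * w, .step ⟨i, rfl⟩ hw, by simp⟩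

/-- An alternating word that contains `h` determines its first factor: all takes place in the free
subgroup generated by `h` and a generator of the centralizer, where the first factor is the initial
power of the reduced word. -/
theorem AltWord.left_unique {α : Type*} {a h : FreeGroup α} (hah : a * h ≠ h * a)
    {c c' v v' : FreeGroup α} (hc : c ∈ Subgroup.centralizer {a})
    (hc' : c' ∈ Subgroup.centralizer {a}) (hv : AltWord (Subgroup.centralizer {a}) h v)
    (hv' : AltWord (Subgroup.centralizer {a}) h v') (heq : c * h * v = c' * h * v') : c = c' := by
  have ha : a ≠ 1 := by rintro rfl; simp at hah
  obtain ⟨u, hu⟩ := centralizer_eq_zpowers a ha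
  have huh : u * h ≠ h * u := by
    intro hcomm
    obtain ⟨n, rfl⟩ : a ∈ Subgroup.zpowers u := hu ▸ Subgroup.mem_centralizer_singleton_iff.2 rfl
    exact hah ((Commute.zpow_left hcomm n))
  have hinj := lift_injective_of_not_commute u h huh
  rw [hu] at hc hc' hv hv'
  obtain ⟨i, rfl⟩ := hc
  obtain ⟨i', rfl⟩ := hc'
  obtain ⟨w, hw, rfl⟩ := hv.exists_lift
  obtain ⟨w', hw', rfl⟩ := hv'.exists_lift
  have heq' : FreeGroup.of 0 ^ i * FreeGroup.of 1 * w =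
      FreeGroup.of 0 ^ i' * FreeGroup.of 1 * w' := by
    apply hinj
    simpa using heq
  obtain ⟨n, b, e1, e2⟩ := toWord_zpow_mul_of i w hw.notMem_toWord
  obtain ⟨n', b', e1', e2'⟩ := toWord_zpow_mul_of i' w' hw'.notMem_toWord
  rw [heq', e2'] at e2
  have e3 := congrArg (List.takeWhile fun p : Fin 2 × Bool => p.1 = 0) e2
  rw [List.takeWhile_append_of_pos (by simp [List.mem_replicate]),
    List.takeWhile_append_of_pos (by simp [List.mem_replicate])] at e3
  simp only [List.takeWhile_cons] at e3
  simp at e3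
  have e4 : FreeGroup.of (0 : Fin 2) ^ i = FreeGroup.of 0 ^ i' := by
    rw [e1, e1', e3.1]
    rcases e3.2 with h0 | h0
    · rw [← e3.1, h0]; rfl
    · rw [h0]
  have := congrArg (FreeGroup.lift ![u, h]) e4
  simpa using this

/-- An alternating word that contains `h` does not commute with `a`. -/
theorem AltWord.step_notMem {α : Type*} {a h : FreeGroup α} (hah : a * h ≠ h * a)
    {c v : FreeGroup α} (hc : c ∈ Subgroup.centralizer {a})
    (hv : AltWord (Subgroup.centralizer {a}) h v) : c * h * v ∉ Subgroup.centralizer {a} := by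
  intro hmem
  -- `a * (c * h * v) = c * h * (v * a)`, whose first factors from the centralizer differ
  have h1 : ∀ v, AltWord (Subgroup.centralizer {a}) h v →
      AltWord (Subgroup.centralizer {a}) h (v * a) := by
    intro v hv
    have haC : a ∈ Subgroup.centralizer {a} := Subgroup.mem_centralizer_singleton_iff.2 rfl
    induction hv with
    | base hc => exact .base (mul_mem hc haC)
    | @step c v hc _ ih => rw [mul_assoc]; exact .step hc ih
  have haC : a ∈ Subgroup.centralizer {a} := Subgroup.mem_centralizer_singleton_iff.2 rfl
  have h2 := AltWord.left_unique hah (mul_mem haC hc) hc hv (h1 v hv) (by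
    have := Subgroup.mem_centralizer_singleton_iff.1 hmem
    rw [mul_assoc a, mul_assoc a, ← this]; group)
  have ha : a = 1 := by simpa using h2
  subst ha
  simp at hah

/-! ### Fixed points of contracting maps on series -/

section FixedPoint

variable {Γ K : Type*} [LinearOrder Γ] [Field K]

theorem ne_zero_of_coeff {x : HahnSeries Γ K} {g : Γ} (hg : x.coeff g ≠ 0) : x ≠ 0 := by
  rintro rfl; simp at hg

/-- Spherical completeness of the space of Hahn series with support in `D`: a map `T` for which each
coefficient of `T x` is determined by the earlier coefficients of `x` has a fixed point. It is
glued from the partial solutions on the lower sets of `Γ`. -/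
theorem exists_fixedPoint (D : Set Γ) (T : HahnSeries Γ K → HahnSeries Γ K)
    (hD : ∀ x, x.support ⊆ D → (T x).support ⊆ D)
    (hT : ∀ x y m, x.support ⊆ D → y.support ⊆ D → (∀ b < m, x.coeff b = y.coeff b) →
      (T x).coeff m = (T y).coeff m) :
    ∃ x, x.support ⊆ D ∧ T x = x := by
  classical
  let Good (I : Set Γ) (x : HahnSeries Γ K) : Prop :=
    IsLowerSet I ∧ x.support ⊆ D ∧ ∀ g ∈ I, (T x).coeff g = x.coeff g
  have huniq : ∀ I x J y, Good I x → Good J y → ∀ g, g ∈ I → g ∈ J → x.coeff g = y.coeff g := by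
    intro I x J y hx hy g hgI hgJ
    by_contra hne
    have hwf : (x.support ∪ y.support).IsWF := x.isWF_support.union y.isWF_support
    have hsub : {g | g ∈ I ∧ g ∈ J ∧ x.coeff g ≠ y.coeff g} ⊆ x.support ∪ y.support := by
      rintro b ⟨-, -, hb⟩
      by_contra hb'
      simp only [Set.mem_union, HahnSeries.mem_support, not_or, not_not] at hb'
      exact hb (hb'.1.trans hb'.2.symm)
    have hwf' := hwf.mono hsub
    have hne' : {g | g ∈ I ∧ g ∈ J ∧ x.coeff g ≠ y.coeff g}.Nonempty := ⟨g, hgI, hgJ, hne⟩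
    obtain ⟨hmI, hmJ, hm⟩ := hwf'.min_mem hne'
    have hlt : ∀ b < hwf'.min hne', x.coeff b = y.coeff b := by
      intro b hb
      by_contra hb'
      exact hwf'.not_lt_min hne' ⟨hx.1 hb.le hmI, hy.1 hb.le hmJ, hb'⟩ hb
    exact hm (by rw [← hx.2.2 _ hmI, ← hy.2.2 _ hmJ]; exact hT _ _ _ hx.2.1 hy.2.1 hlt)
  let c : Γ → K := fun g =>
    if h : ∃ (I : Set Γ) (x : HahnSeries Γ K), Good I x ∧ g ∈ I then h.choose_spec.choose.coeff g
    else 0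
  have hc : ∀ I x, Good I x → ∀ g ∈ I, c g = x.coeff g := by
    intro I x hx g hg
    have h : ∃ (I : Set Γ) (x : HahnSeries Γ K), Good I x ∧ g ∈ I := ⟨I, x, hx, hg⟩
    simp only [c, dif_pos h]
    exact huniq _ _ _ _ h.choose_spec.choose_spec.1 hx g h.choose_spec.choose_spec.2 hg
  have hc0 : ∀ g, c g ≠ 0 → ∃ I x, Good I x ∧ g ∈ I := by
    intro g hg
    by_contra h
    exact hg (dif_neg h)
  have hpwo : (Function.support c).IsPWO := by
    rw [Set.isPWO_iff_isWF, Set.isWF_iff_no_descending_seq]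
    intro f hf hmem
    obtain ⟨I, x, hx, hgI⟩ := hc0 (f 0) (hmem 0)
    have hI : ∀ n, f n ∈ I := fun n => hx.1 (hf.antitone (Nat.zero_le n)) hgI
    refine Set.isWF_iff_no_descending_seq.1 x.isWF_support f hf fun n => ?_
    have := hmem n
    rw [Function.mem_support, hc I x hx _ (hI n)] at this
    exact this
  let z : HahnSeries Γ K := ⟨c, hpwo⟩
  have hzD : z.support ⊆ D := by
    intro g hg
    obtain ⟨I, x, hx, hgI⟩ := hc0 g hg
    have hg' : c g ≠ 0 := hg
    rw [hc I x hx g hgI] at hg'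
    exact hx.2.1 hg'
  let U : Set Γ := {g | ∃ I x, Good I x ∧ g ∈ I}
  have hzU : ∀ g ∈ U, (T z).coeff g = z.coeff g := by
    rintro g ⟨I, x, hx, hg⟩
    have h1 : z.coeff g = x.coeff g := hc I x hx g hg
    rw [h1, ← hx.2.2 g hg]
    exact hT _ _ _ hzD hx.2.1 fun b hb => hc I x hx b (hx.1 hb.le hg)
  have hUlow : IsLowerSet U := by
    rintro g b hbg ⟨I, x, hx, hg⟩
    exact ⟨I, x, hx, hx.1 hbg hg⟩
  refine ⟨z, hzD, ?_⟩
  by_contra hne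
  have hr : T z - z ≠ 0 := sub_ne_zero.2 hne
  have hsne : (T z - z).support.Nonempty := HahnSeries.support_nonempty_iff.2 hr
  set β := (T z - z).isWF_support.min hsne with hβ
  have hβmem : (T z - z).coeff β ≠ 0 := (T z - z).isWF_support.min_mem hsne
  have hβlt : ∀ g < β, (T z - z).coeff g = 0 := by
    intro g hg
    by_contra h
    exact (T z - z).isWF_support.not_lt_min hsne h hg
  have hβU : β ∉ U := fun h => hβmem (by rw [HahnSeries.coeff_sub, hzU _ h, sub_self])
  have hzβ : z.coeff β = 0 := by
    by_contra h
    exact hβU (hc0 β h)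
  -- extending `z` by the first term of the defect solves the equation on a larger lower set
  let z' : HahnSeries Γ K := z + HahnSeries.single β ((T z - z).coeff β)
  have hz'D : z'.support ⊆ D := by
    intro g hg
    by_cases hgβ : g = β
    · subst hgβ
      apply hD z hzD
      rw [HahnSeries.coeff_sub, hzβ, sub_zero] at hβmem
      exact hβmem
    · apply hzD
      simpa [z', HahnSeries.coeff_single_of_ne hgβ] using hg
  have hgood : Good {g | g ≤ β} z' := by
    refine ⟨fun g b hbg hg => hbg.trans hg, hz'D, fun g hg => ?_⟩
    have h1 : (T z').coeff g = (T z).coeff g := by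
      refine hT _ _ _ hz'D hzD fun b hb => ?_
      have : b ≠ β := (hb.trans_le hg).ne
      simp [z', HahnSeries.coeff_single_of_ne this]
    rw [h1]
    rcases eq_or_lt_of_le (show g ≤ β from hg) with h | h
    · subst h
      simp [z']
    · have h2 := hβlt g h
      rw [HahnSeries.coeff_sub, sub_eq_zero] at h2
      simp [z', HahnSeries.coeff_single_of_ne h.ne, h2]
  exact hβU ⟨_, z', hgood, le_refl β⟩

end FixedPoint

/-! ### The Malcev–Neumann ring -/

section Ring

variable {Γ K : Type*} [Group Γ] [LinearOrder Γ] [Field K]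

noncomputable instance instOneSeries : One (HahnSeries Γ K) where
  one := HahnSeries.single 1 1

theorem one_def : (1 : HahnSeries Γ K) = HahnSeries.single 1 1 := rfl

variable [MulLeftStrictMono Γ] [MulRightStrictMono Γ]

theorem finite_mul_antidiagonal {s t : Set Γ} (hs : s.IsPWO) (ht : t.IsPWO) (g : Γ) :
    {a | a ∈ s ∧ a⁻¹ * g ∈ t}.Finite := by
  by_contra hinf
  have hinf : {a | a ∈ s ∧ a⁻¹ * g ∈ t}.Infinite := hinf
  let e := hinf.natEmbedding
  obtain ⟨φ, hφ⟩ := hs.exists_monotone_subseq (f := fun n => (e n : Γ)) fun n => (e n).2.1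
  have hmono : StrictMono fun n => (e (φ n) : Γ) :=
    Monotone.strictMono_of_injective (fun m n h => hφ h)
      (Subtype.val_injective.comp (e.injective.comp φ.injective))
  refine Set.isWF_iff_no_descending_seq.1 ht.isWF (fun n => (e (φ n) : Γ)⁻¹ * g) ?_
    fun n => (e (φ n)).2.2
  intro m n hmn
  exact mul_lt_mul_left (inv_lt_inv_iff.2 (hmono hmn)) g

theorem isPWO_image_mul {s t : Set Γ} (hs : s.IsPWO) (ht : t.IsPWO) :
    ((fun p : Γ × Γ => p.1 * p.2) '' s ×ˢ t).IsPWO :=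
  have := mulLeftMono_of_mulLeftStrictMono Γ
  have := mulRightMono_of_mulRightStrictMono Γ
  (hs.prod ht).image_of_monotone fun _ _ h => mul_le_mul' h.1 h.2

theorem finite_support_mul (x y : HahnSeries Γ K) (g : Γ) :
    (Function.support fun a => x.coeff a * y.coeff (a⁻¹ * g)).Finite :=
  (finite_mul_antidiagonal x.isPWO_support y.isPWO_support g).subset fun a ha => by
    rw [Function.mem_support] at ha
    exact ⟨left_ne_zero_of_mul ha, right_ne_zero_of_mul ha⟩

/-- The convolution product of Malcev–Neumann series, that is, of series over an ordered group,
written multiplicatively and not necessarily commutative, with well-ordered supports. -/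
noncomputable instance instMulSeries : Mul (HahnSeries Γ K) where
  mul x y :=
    { coeff := fun g => ∑ᶠ a, x.coeff a * y.coeff (a⁻¹ * g)
      isPWO_support' := by
        refine (isPWO_image_mul x.isPWO_support y.isPWO_support).mono fun g hg => ?_
        obtain ⟨a, ha⟩ : ∃ a, x.coeff a * y.coeff (a⁻¹ * g) ≠ 0 := by
          by_contra h
          push Not at h
          exact hg (finsum_eq_zero_of_forall_eq_zero h)
        exact ⟨(a, a⁻¹ * g), ⟨left_ne_zero_of_mul ha, right_ne_zero_of_mul ha⟩, by simp⟩ }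

theorem coeff_mul (x y : HahnSeries Γ K) (g : Γ) :
    (x * y).coeff g = ∑ᶠ a, x.coeff a * y.coeff (a⁻¹ * g) := rfl

theorem coeff_single_mul (a : Γ) (r : K) (x : HahnSeries Γ K) (g : Γ) :
    (HahnSeries.single a r * x).coeff g = r * x.coeff (a⁻¹ * g) := by
  rw [coeff_mul, finsum_eq_single _ a fun b hb => by
    rw [HahnSeries.coeff_single_of_ne hb, zero_mul], HahnSeries.coeff_single_same]

theorem coeff_mul_single (x : HahnSeries Γ K) (a : Γ) (r : K) (g : Γ) :
    (x * HahnSeries.single a r).coeff g = x.coeff (g * a⁻¹) * r := by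
  rw [coeff_mul, finsum_eq_single _ (g * a⁻¹)]
  · simp
  · intro b hb
    rw [HahnSeries.coeff_single_of_ne, mul_zero]
    rintro rfl
    apply hb
    group

theorem series_mul_assoc (x y z : HahnSeries Γ K) : x * y * z = x * (y * z) := by
  ext g
  let F : Γ × Γ → K := fun p => x.coeff p.1 * y.coeff (p.1⁻¹ * p.2) * z.coeff (p.2⁻¹ * g)
  have hF : (Function.support F).Finite := by
    have h1 := finite_mul_antidiagonal (isPWO_image_mul x.isPWO_support y.isPWO_support)
      z.isPWO_support g
    refine (h1.biUnion fun c _ => (finite_mul_antidiagonal x.isPWO_support y.isPWO_support c).image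
      fun a => (a, c)).subset ?_
    rintro ⟨a, c⟩ h
    have hz : z.coeff (c⁻¹ * g) ≠ 0 := right_ne_zero_of_mul h
    have hxy := left_ne_zero_of_mul h
    have hx : x.coeff a ≠ 0 := left_ne_zero_of_mul hxy
    have hy : y.coeff (a⁻¹ * c) ≠ 0 := right_ne_zero_of_mul hxy
    simp only [Set.mem_iUnion]
    exact ⟨c, ⟨⟨(a, a⁻¹ * c), ⟨hx, hy⟩, by simp⟩, hz⟩, a, ⟨hx, hy⟩, rfl⟩
  have hL : (x * y * z).coeff g = ∑ᶠ c, ∑ᶠ a, F (a, c) := by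
    rw [coeff_mul]
    refine finsum_congr fun c => ?_
    rw [coeff_mul, finsum_mul]
  have hR : (x * (y * z)).coeff g = ∑ᶠ a, ∑ᶠ c, F (a, c) := by
    rw [coeff_mul]
    refine finsum_congr fun a => ?_
    rw [coeff_mul, mul_finsum,
      ← finsum_comp_equiv (Equiv.mulLeft a⁻¹)]
    refine finsum_congr fun c => ?_
    simp only [F, Equiv.coe_mulLeft]
    rw [mul_assoc]
    congr 3
    group
  have hF' : (Function.support fun p : Γ × Γ => F (p.2, p.1)).Finite := by
    refine (hF.preimage (f := Prod.swap) (Prod.swap_injective.injOn)).subset fun p hp => hp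
  rw [hL, hR, ← finsum_curry F hF, ← finsum_curry _ hF', ← finsum_comp_equiv (Equiv.prodComm Γ Γ)]
  rfl

/-- The Malcev–Neumann ring of an ordered group. -/
noncomputable instance instRingSeries : Ring (HahnSeries Γ K) where
  __ := (inferInstance : AddCommGroup (HahnSeries Γ K))
  __ := instMulSeries
  __ := instOneSeries
  left_distrib x y z := by
    ext g
    rw [HahnSeries.coeff_add, coeff_mul, coeff_mul, coeff_mul,
      ← finsum_add_distrib (finite_support_mul x y g) (finite_support_mul x z g)]
    exact finsum_congr fun a => by rw [HahnSeries.coeff_add, mul_add]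
  right_distrib x y z := by
    ext g
    rw [HahnSeries.coeff_add, coeff_mul, coeff_mul, coeff_mul,
      ← finsum_add_distrib (finite_support_mul x z g) (finite_support_mul y z g)]
    exact finsum_congr fun a => by rw [HahnSeries.coeff_add, add_mul]
  zero_mul x := by ext g; simp [coeff_mul]
  mul_zero x := by ext g; simp [coeff_mul]
  mul_assoc := series_mul_assoc
  one_mul x := by ext g; rw [one_def, coeff_single_mul]; simp
  mul_one x := by ext g; rw [one_def, coeff_mul_single]; simp

noncomputable instance instAlgebraSeries : Algebra K (HahnSeries Γ K) :=
  Algebra.ofModule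
    (fun r x y => by
      ext g
      rw [HahnSeries.coeff_smul, coeff_mul, coeff_mul, smul_eq_mul,
        mul_finsum]
      exact finsum_congr fun a => by rw [HahnSeries.coeff_smul, smul_eq_mul, mul_assoc])
    (fun r x y => by
      ext g
      rw [HahnSeries.coeff_smul, coeff_mul, coeff_mul, smul_eq_mul,
        mul_finsum]
      exact finsum_congr fun a => by rw [HahnSeries.coeff_smul, smul_eq_mul, mul_left_comm])

theorem single_mul_single (a b : Γ) (r s : K) :
    HahnSeries.single a r * HahnSeries.single b s = HahnSeries.single (a * b) (r * s) := by
  ext g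
  rw [coeff_single_mul]
  by_cases h : g = a * b
  · subst h; simp
  · rw [HahnSeries.coeff_single_of_ne h, HahnSeries.coeff_single_of_ne, mul_zero]
    rintro h'
    exact h (by rw [← h']; group)

end Ring

/-! ### Leading exponents -/

section Lead

variable {Γ K : Type*} [Group Γ] [LinearOrder Γ] [Field K]

open Classical in
/-- The first element of the support of a series, with the value `1` at `0`. -/
noncomputable def lead (x : HahnSeries Γ K) : Γ :=
  if h : x = 0 then 1 else x.isWF_support.min (HahnSeries.support_nonempty_iff.2 h)

theorem coeff_lead_ne_zero {x : HahnSeries Γ K} (hx : x ≠ 0) : x.coeff (lead x) ≠ 0 := by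
  rw [lead, dif_neg hx]
  exact x.isWF_support.min_mem (HahnSeries.support_nonempty_iff.2 hx)

theorem lead_le {x : HahnSeries Γ K} {g : Γ} (hg : x.coeff g ≠ 0) : lead x ≤ g := by
  have hx : x ≠ 0 := by rintro rfl; simp at hg
  rw [lead, dif_neg hx]
  exact x.isWF_support.min_le _ hg

theorem coeff_eq_zero_of_lt_lead {x : HahnSeries Γ K} {g : Γ} (hg : g < lead x) :
    x.coeff g = 0 := by
  by_contra h
  exact (lead_le h).not_gt hg

theorem lead_eq_of {x : HahnSeries Γ K} {m : Γ} (hm : x.coeff m ≠ 0)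
    (hlt : ∀ g < m, x.coeff g = 0) : lead x = m := by
  refine le_antisymm (lead_le hm) (not_lt.1 fun h => ?_)
  exact coeff_lead_ne_zero (ne_zero_of_coeff hm) (hlt _ h)

variable [MulLeftStrictMono Γ] [MulRightStrictMono Γ]

theorem coeff_mul_lead (x y : HahnSeries Γ K) :
    (x * y).coeff (lead x * lead y) = x.coeff (lead x) * y.coeff (lead y) := by
  rw [coeff_mul, finsum_eq_single _ (lead x)]
  · simp
  · intro b hb
    rcases lt_or_gt_of_ne hb with h | h
    · rw [coeff_eq_zero_of_lt_lead h, zero_mul]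
    · rw [coeff_eq_zero_of_lt_lead (x := y), mul_zero]
      rw [inv_mul_lt_iff_lt_mul]
      exact mul_lt_mul_left h _

theorem coeff_mul_eq_zero_of_lt {x y : HahnSeries Γ K} {p q g : Γ} (hx : ∀ a < p, x.coeff a = 0)
    (hy : ∀ a < q, y.coeff a = 0) (hg : g < p * q) : (x * y).coeff g = 0 := by
  rw [coeff_mul]
  refine finsum_eq_zero_of_forall_eq_zero fun a => ?_
  rcases lt_or_ge a p with h | h
  · rw [hx a h, zero_mul]
  · have := mulRightMono_of_mulRightStrictMono Γ
    rw [hy, mul_zero]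
    rw [inv_mul_lt_iff_lt_mul]
    exact hg.trans_le (mul_le_mul_left h q)

theorem lead_mul {x y : HahnSeries Γ K} (hx : x ≠ 0) (hy : y ≠ 0) :
    x * y ≠ 0 ∧ lead (x * y) = lead x * lead y := by
  have h : (x * y).coeff (lead x * lead y) ≠ 0 := by
    rw [coeff_mul_lead]
    exact mul_ne_zero (coeff_lead_ne_zero hx) (coeff_lead_ne_zero hy)
  exact ⟨ne_zero_of_coeff h, lead_eq_of h fun g hg =>
    coeff_mul_eq_zero_of_lt (fun a => coeff_eq_zero_of_lt_lead)
      (fun a => coeff_eq_zero_of_lt_lead) hg⟩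

/-- If all exponents of `s` exceed `1`, then a coefficient of `s * x` only depends on the earlier
coefficients of `x`. -/
theorem coeff_mul_congr_right {s x y : HahnSeries Γ K} {m : Γ} (hs : s.support ⊆ Set.Ioi 1)
    (h : ∀ b < m, x.coeff b = y.coeff b) : (s * x).coeff m = (s * y).coeff m := by
  rw [coeff_mul, coeff_mul]
  refine finsum_congr fun a => ?_
  by_cases ha : s.coeff a = 0
  · rw [ha, zero_mul, zero_mul]
  · rw [h]
    have : 1 < a := hs ha
    rw [inv_mul_lt_iff_lt_mul]
    exact lt_mul_of_one_lt_left' m this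

theorem coeff_mul_congr_left {s x y : HahnSeries Γ K} {m : Γ} (hs : s.support ⊆ Set.Ioi 1)
    (h : ∀ b < m, x.coeff b = y.coeff b) : (x * s).coeff m = (y * s).coeff m := by
  rw [coeff_mul, coeff_mul]
  refine finsum_congr fun a => ?_
  by_cases ha : s.coeff (a⁻¹ * m) = 0
  · rw [ha, mul_zero, mul_zero]
  · rw [h]
    have : 1 < a⁻¹ * m := hs ha
    rw [lt_inv_mul_iff_mul_lt, mul_one] at this
    exact this

/-- Left multiplication by a series with constant term `1` and all other exponents greater than `1`
is surjective. -/
theorem exists_one_add_mul_eq {t : HahnSeries Γ K} (ht : t.support ⊆ Set.Ioi 1)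
    (w : HahnSeries Γ K) : ∃ x, (1 + t) * x = w := by
  obtain ⟨x, -, hx⟩ := exists_fixedPoint (K := K) (Set.univ : Set Γ) (fun x => w - t * x)
    (fun _ _ => Set.subset_univ _) (fun x y m _ _ h => by
      rw [HahnSeries.coeff_sub, HahnSeries.coeff_sub, coeff_mul_congr_right ht h])
  refine ⟨x, ?_⟩
  rw [add_mul, one_mul]
  nth_rewrite 1 [← hx]
  abel

end Lead

/-! ### Conjugation into a centralizer -/

section Restrict

variable {Γ K : Type*} [LinearOrder Γ] [Field K]

open Classical in
/-- The part of a series that is supported in the set `S`. -/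
noncomputable def restrict (S : Set Γ) (x : HahnSeries Γ K) : HahnSeries Γ K where
  coeff g := if g ∈ S then x.coeff g else 0
  isPWO_support' := x.isPWO_support.mono fun g hg => by
    rw [Function.mem_support] at hg
    exact fun h => hg (by simp [h])

theorem coeff_restrict_of_mem {S : Set Γ} {g : Γ} (hg : g ∈ S) (x : HahnSeries Γ K) :
    (restrict S x).coeff g = x.coeff g := if_pos hg

theorem coeff_restrict_of_notMem {S : Set Γ} {g : Γ} (hg : g ∉ S) (x : HahnSeries Γ K) :
    (restrict S x).coeff g = 0 := if_neg hg

theorem support_restrict_subset (S : Set Γ) (x : HahnSeries Γ K) :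
    (restrict S x).support ⊆ S := by
  intro g hg
  by_contra h
  exact hg (coeff_restrict_of_notMem h x)

theorem coeff_eq_zero_of_support {S : Set Γ} {x : HahnSeries Γ K} (hx : x.support ⊆ S) {g : Γ}
    (hg : g ∉ S) : x.coeff g = 0 := by
  by_contra h
  exact hg (hx h)

end Restrict

section LeadAdd

variable {Γ K : Type*} [Group Γ] [LinearOrder Γ] [Field K]

theorem lead_add_of_lt {x y : HahnSeries Γ K} (hx : x ≠ 0) (h : y = 0 ∨ lead x < lead y) :
    x + y ≠ 0 ∧ lead (x + y) = lead x := by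
  have hy : ∀ g ≤ lead x, y.coeff g = 0 := by
    intro g hg
    rcases h with rfl | h
    · rfl
    · exact coeff_eq_zero_of_lt_lead (hg.trans_lt h)
  have hc : (x + y).coeff (lead x) ≠ 0 := by
    rw [HahnSeries.coeff_add, hy _ le_rfl, add_zero]
    exact coeff_lead_ne_zero hx
  exact ⟨ne_zero_of_coeff hc, lead_eq_of hc fun g hg => by
    rw [HahnSeries.coeff_add, hy _ hg.le, coeff_eq_zero_of_lt_lead hg, add_zero]⟩

theorem lead_neg (x : HahnSeries Γ K) : lead (-x) = lead x := by
  by_cases hx : x = 0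
  · rw [hx, neg_zero]
  · refine lead_eq_of ?_ fun g hg => ?_
    · rw [HahnSeries.coeff_neg]
      exact neg_ne_zero.2 (coeff_lead_ne_zero hx)
    · rw [HahnSeries.coeff_neg, coeff_eq_zero_of_lt_lead hg, neg_zero]

end LeadAdd

theorem support_one_subset {Γ K : Type*} [Group Γ] [LinearOrder Γ] [Field K]
    (C : Subgroup Γ) : (1 : HahnSeries Γ K).support ⊆ C := by
  intro g hg
  by_contra h
  apply hg
  rw [one_def, HahnSeries.coeff_single_of_ne]
  rintro rfl
  exact h (one_mem C)

section Conjugation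

variable {Γ K : Type*} [Group Γ] [LinearOrder Γ] [MulLeftStrictMono Γ] [MulRightStrictMono Γ]
  [Field K]

theorem support_mul_subset_Ioi {x y : HahnSeries Γ K} (hx : x.support ⊆ Set.Ioi 1)
    (hy : y.support ⊆ Set.Ioi 1) : (x * y).support ⊆ Set.Ioi 1 := by
  have := mulLeftMono_of_mulLeftStrictMono Γ
  intro g hg
  by_contra h
  apply hg
  rw [coeff_mul]
  refine finsum_eq_zero_of_forall_eq_zero fun a => ?_
  by_cases ha : x.coeff a = 0
  · rw [ha, zero_mul]
  · rw [coeff_eq_zero_of_support hy, mul_zero]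
    have h1 : 1 < a := hx ha
    simp only [Set.mem_Ioi, not_lt] at h ⊢
    rw [inv_mul_le_iff_le_mul, mul_one]
    exact h.trans h1.le

theorem support_mul_subset_subgroup {C : Subgroup Γ} {x y : HahnSeries Γ K}
    (hx : x.support ⊆ C) (hy : y.support ⊆ C) : (x * y).support ⊆ C := by
  intro g hg
  by_contra h
  apply hg
  rw [coeff_mul]
  refine finsum_eq_zero_of_forall_eq_zero fun a => ?_
  by_cases ha : x.coeff a = 0
  · rw [ha, zero_mul]
  · rw [coeff_eq_zero_of_support hy, mul_zero]
    intro h2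
    apply h
    have := mul_mem (show a ∈ C from hx ha) h2
    simpa using this

theorem mul_comm_of_support {C : Subgroup Γ} (hC : ∀ a ∈ C, ∀ b ∈ C, a * b = b * a)
    {x y : HahnSeries Γ K} (hx : x.support ⊆ C) (hy : y.support ⊆ C) : x * y = y * x := by
  ext g
  by_cases hg : g ∈ C
  · rw [coeff_mul, coeff_mul, ← finsum_comp_equiv ((Equiv.inv Γ).trans (Equiv.mulLeft g))]
    refine finsum_congr fun b => ?_
    simp only [Equiv.trans_apply, Equiv.inv_apply, Equiv.coe_mulLeft]
    by_cases hb : b ∈ C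
    · rw [hC g hg _ (inv_mem hb), mul_comm]
      congr 2
      rw [mul_inv_rev, inv_inv, hC _ (inv_mem hg) _ hb]
      group
    · rw [coeff_eq_zero_of_support hy hb, zero_mul, coeff_eq_zero_of_support hy (g := _ * g),
        mul_zero]
      intro h
      apply hb
      simpa using h
  · rw [coeff_eq_zero_of_support (support_mul_subset_subgroup hx hy) hg,
      coeff_eq_zero_of_support (support_mul_subset_subgroup hy hx) hg]

/-- An approximate solution `t` of `t - a * t * a⁻¹ = y` off the centralizer of `a`: the exponent `g`
of `y` is left in place if conjugation by `a` increases it, and is moved by `a⁻¹` otherwise. In both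
cases the error only involves conjugates of the exponents of `y` that are larger than these. -/
noncomputable def conjSolve (a : Γ) (y : HahnSeries Γ K) : HahnSeries Γ K where
  coeff g := if g < a * g * a⁻¹ then y.coeff g
    else if a * g * a⁻¹ < g then -y.coeff (a * g * a⁻¹) else 0
  isPWO_support' := by
    have := mulLeftMono_of_mulLeftStrictMono Γ
    have := mulRightMono_of_mulRightStrictMono Γ
    have h : ((fun b => a⁻¹ * b * a) '' y.support).IsPWO :=
      y.isPWO_support.image_of_monotone fun b b' hb =>
        mul_le_mul_left (mul_le_mul_right hb _) _
    refine (y.isPWO_support.union h).mono fun g hg => ?_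
    rw [Function.mem_support] at hg
    split_ifs at hg with h1 h2
    · exact Or.inl hg
    · exact Or.inr ⟨a * g * a⁻¹, fun h => hg (by rw [h, neg_zero]), by group⟩
    · exact absurd rfl hg

theorem lt_conj_iff (a g : Γ) : a⁻¹ * g * a < g ↔ g < a * g * a⁻¹ := by
  rw [mul_assoc, inv_mul_lt_iff_lt_mul, lt_mul_inv_iff_mul_lt]

theorem conj_lt_iff (a g : Γ) : g < a⁻¹ * g * a ↔ a * g * a⁻¹ < g := by
  rw [mul_assoc, lt_inv_mul_iff_mul_lt, mul_inv_lt_iff_lt_mul]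

/-- Every nonzero series is conjugate, by a series with constant term `1` and all other exponents
greater than `1`, to a series supported in the centralizer of its leading exponent. -/
theorem exists_conj_centralizer (F : HahnSeries Γ K) (hF : F ≠ 0) :
    ∃ t φ : HahnSeries Γ K, t.support ⊆ Set.Ioi 1 ∧
      φ.support ⊆ (Subgroup.centralizer {lead F} : Set Γ) ∧ F * (1 + t) = (1 + t) * φ := by
  have := mulLeftMono_of_mulLeftStrictMono Γ
  have := mulRightMono_of_mulRightStrictMono Γ
  set a := lead F with ha
  set r := F.coeff a with hr
  have hr0 : r ≠ 0 := coeff_lead_ne_zero hF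
  set A : HahnSeries Γ K := HahnSeries.single a r with hA
  set A' : HahnSeries Γ K := HahnSeries.single a⁻¹ r⁻¹ with hA'
  have hAA' : A * A' = 1 := by
    rw [hA, hA', single_mul_single, mul_inv_cancel, mul_inv_cancel₀ hr0]; rfl
  have hA'A : A' * A = 1 := by
    rw [hA, hA', single_mul_single, inv_mul_cancel, inv_mul_cancel₀ hr0]; rfl
  let s : HahnSeries Γ K := F * A' - 1
  have hs : s.support ⊆ Set.Ioi 1 := by
    intro g hg
    by_contra h
    apply hg
    simp only [Set.mem_Ioi, not_lt] at h
    simp only [s, HahnSeries.coeff_sub, hA', coeff_mul_single, one_def, inv_inv]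
    rcases eq_or_lt_of_le h with rfl | h
    · rw [one_mul, ← hr, HahnSeries.coeff_single_same, mul_inv_cancel₀ hr0, sub_self]
    · rw [HahnSeries.coeff_single_of_ne h.ne, coeff_eq_zero_of_lt_lead, zero_mul, sub_zero]
      rw [← ha]
      exact mul_lt_of_lt_one_left' a h
  have hFs : F = (1 + s) * A := by
    simp only [s]
    rw [add_sub_cancel, mul_assoc, hA'A, mul_one]
  -- conjugation by the leading term
  let σ : HahnSeries Γ K → HahnSeries Γ K := fun t => A * t * A'
  have hσ : ∀ t g, (σ t).coeff g = t.coeff (a⁻¹ * g * a) := by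
    intro t g
    simp only [σ, hA, hA']
    rw [coeff_mul_single, coeff_single_mul, inv_inv, mul_assoc a⁻¹, mul_comm r, mul_assoc,
      mul_inv_cancel₀ hr0, mul_one]
  set C : Set Γ := (Subgroup.centralizer {a} : Set Γ) with hC
  have hCmem : ∀ g, g ∈ C ↔ a * g * a⁻¹ = g := by
    intro g
    rw [hC, SetLike.mem_coe, Subgroup.mem_centralizer_singleton_iff, mul_inv_eq_iff_eq_mul]
    exact eq_comm
  let τ : HahnSeries Γ K → HahnSeries Γ K := conjSolve a
  have hτ_up : ∀ y g, g < a * g * a⁻¹ → (τ y).coeff g = y.coeff g := fun y g h => if_pos h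
  have hτ_down : ∀ y g, a * g * a⁻¹ < g → (τ y).coeff g = -y.coeff (a * g * a⁻¹) :=
    fun y g h => (if_neg h.not_gt).trans (if_pos h)
  have hτ_eq : ∀ y g, a * g * a⁻¹ = g → (τ y).coeff g = 0 :=
    fun y g h => (if_neg h.not_gt).trans (if_neg h.not_lt)
  have hconj : ∀ g, a * (a⁻¹ * g * a) * a⁻¹ = g := fun g => by group
  have hστ_up : ∀ y g, g < a * g * a⁻¹ → (σ (τ y)).coeff g = y.coeff (a⁻¹ * g * a) := by
    intro y g h
    rw [hσ, hτ_up]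
    rw [hconj]
    exact (lt_conj_iff a g).2 h
  have hστ_down : ∀ y g, a * g * a⁻¹ < g → (σ (τ y)).coeff g = -y.coeff g := by
    intro y g h
    rw [hσ, hτ_down, hconj]
    rw [hconj]
    exact (conj_lt_iff a g).2 h
  have hστ_eq : ∀ y g, a * g * a⁻¹ = g → (σ (τ y)).coeff g = 0 := by
    intro y g h
    have h' : a⁻¹ * g * a = g := by
      conv_lhs => rw [← h]
      group
    rw [hσ, h', hτ_eq y g h]
  have hpos : ∀ g, a * g * a⁻¹ ≤ 1 ↔ g ≤ 1 := by
    intro g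
    rw [mul_inv_le_iff_le_mul, one_mul]
    exact mul_le_iff_le_one_right' a
  have hpos' : ∀ g, a⁻¹ * g * a ≤ 1 ↔ g ≤ 1 := by
    intro g
    conv_rhs => rw [← hconj g]
    rw [hpos]
  have hIoi : ∀ y : HahnSeries Γ K, y.support ⊆ Set.Ioi 1 ↔ ∀ g ≤ 1, y.coeff g = 0 := by
    intro y
    refine ⟨fun h g hg => coeff_eq_zero_of_support h (by simpa using hg), fun h g hg => ?_⟩
    by_contra h'
    exact hg (h g (by simpa using h'))
  have hτD : ∀ y : HahnSeries Γ K, y.support ⊆ Set.Ioi 1 → (τ y).support ⊆ Set.Ioi 1 := by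
    intro y hy
    rw [hIoi] at hy ⊢
    intro g hg
    rcases lt_trichotomy g (a * g * a⁻¹) with h | h | h
    · rw [hτ_up y g h, hy g hg]
    · exact hτ_eq y g h.symm
    · rw [hτ_down y g h, hy _ ((hpos g).2 hg), neg_zero]
  have hσD : ∀ y : HahnSeries Γ K, y.support ⊆ Set.Ioi 1 → (σ y).support ⊆ Set.Ioi 1 := by
    intro y hy
    rw [hIoi] at hy ⊢
    intro g hg
    rw [hσ, hy _ ((hpos' g).2 hg)]
  have hψD : ∀ y : HahnSeries Γ K, y.support ⊆ Set.Ioi 1 → (restrict C y).support ⊆ Set.Ioi 1 := by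
    intro y hy
    rw [hIoi] at hy ⊢
    intro g hg
    by_cases h : g ∈ C
    · rw [coeff_restrict_of_mem h, hy g hg]
    · rw [coeff_restrict_of_notMem h]
  -- With `t = τ y` and `φ = (1 + restrict C y) * A`, the equation `F * (1 + t) = (1 + t) * φ` says that
  -- `s + σ t + s * σ t = restrict C y + t + t * restrict C y`, that is, `T y = y`.
  let T : HahnSeries Γ K → HahnSeries Γ K := fun y =>
    s + s * σ (τ y) - τ y * restrict C y + (y - τ y + σ (τ y) - restrict C y)
  obtain ⟨y, hyD, hy⟩ := exists_fixedPoint (Set.Ioi (1 : Γ)) T (by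
    intro y hy
    have h1 := hIoi _ |>.1 hs
    have h2 := hIoi _ |>.1 (support_mul_subset_Ioi hs (hσD _ (hτD y hy)))
    have h3 := hIoi _ |>.1 (support_mul_subset_Ioi (hτD y hy) (hψD y hy))
    have h4 := hIoi _ |>.1 hy
    have h5 := hIoi _ |>.1 (hτD y hy)
    have h6 := hIoi _ |>.1 (hσD _ (hτD y hy))
    have h7 := hIoi _ |>.1 (hψD y hy)
    rw [hIoi]
    intro g hg
    simp only [T, HahnSeries.coeff_add, HahnSeries.coeff_sub]
    rw [h1 g hg, h2 g hg, h3 g hg, h4 g hg, h5 g hg, h6 g hg, h7 g hg]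
    ring) (by
    intro x y m hx hy hxy
    have e1 : ∀ b < m, (τ x).coeff b = (τ y).coeff b := by
      intro b hb
      rcases lt_trichotomy b (a * b * a⁻¹) with h | h | h
      · rw [hτ_up x b h, hτ_up y b h, hxy b hb]
      · rw [hτ_eq x b h.symm, hτ_eq y b h.symm]
      · rw [hτ_down x b h, hτ_down y b h, hxy _ (h.trans hb)]
    have e2 : ∀ b < m, (σ (τ x)).coeff b = (σ (τ y)).coeff b := by
      intro b hb
      rcases lt_trichotomy b (a * b * a⁻¹) with h | h | h
      · rw [hστ_up x b h, hστ_up y b h, hxy _ (((lt_conj_iff a b).2 h).trans hb)]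
      · rw [hστ_eq x b h.symm, hστ_eq y b h.symm]
      · rw [hστ_down x b h, hστ_down y b h, hxy b hb]
    have e3 : ∀ b < m, (restrict C x).coeff b = (restrict C y).coeff b := by
      intro b hb
      by_cases h : b ∈ C
      · rw [coeff_restrict_of_mem h, coeff_restrict_of_mem h, hxy b hb]
      · rw [coeff_restrict_of_notMem h, coeff_restrict_of_notMem h]
    have e4 : (x - τ x + σ (τ x) - restrict C x).coeff m =
        (y - τ y + σ (τ y) - restrict C y).coeff m := by
      simp only [HahnSeries.coeff_add, HahnSeries.coeff_sub]
      rcases lt_trichotomy m (a * m * a⁻¹) with h | h | h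
      · have hm : m ∉ C := fun h' => h.ne ((hCmem m).1 h').symm
        rw [hτ_up x m h, hτ_up y m h, hστ_up x m h, hστ_up y m h, coeff_restrict_of_notMem hm,
          coeff_restrict_of_notMem hm, hxy _ ((lt_conj_iff a m).2 h)]
        ring
      · have hm : m ∈ C := (hCmem m).2 h.symm
        rw [hτ_eq x m h.symm, hτ_eq y m h.symm, hστ_eq x m h.symm, hστ_eq y m h.symm,
          coeff_restrict_of_mem hm, coeff_restrict_of_mem hm]
        ring
      · have hm : m ∉ C := fun h' => h.ne ((hCmem m).1 h')
        rw [hτ_down x m h, hτ_down y m h, hστ_down x m h, hστ_down y m h,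
          coeff_restrict_of_notMem hm, coeff_restrict_of_notMem hm, hxy _ h]
        ring
    have e5 := coeff_mul_congr_right hs e2
    have e6 : (τ x * restrict C x).coeff m = (τ y * restrict C y).coeff m :=
      (coeff_mul_congr_right (hτD x hx) e3).trans (coeff_mul_congr_left (hψD y hy) e1)
    simp only [T]
    rw [HahnSeries.coeff_add, e4, HahnSeries.coeff_sub, e6, HahnSeries.coeff_add, e5]
    simp only [HahnSeries.coeff_add, HahnSeries.coeff_sub])
  refine ⟨τ y, (1 + restrict C y) * A, hτD y hyD, ?_, ?_⟩
  · have h1C : (1 : HahnSeries Γ K).support ⊆ C := support_one_subset _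
    refine support_mul_subset_subgroup ?_ ?_
    · intro g hg
      by_contra h
      apply hg
      rw [HahnSeries.coeff_add, coeff_eq_zero_of_support h1C h, coeff_restrict_of_notMem h,
        add_zero]
    · intro g hg
      by_contra h
      apply hg
      rw [hA, HahnSeries.coeff_single_of_ne]
      rintro rfl
      exact h (Subgroup.mem_centralizer_singleton_iff.2 rfl)
  · have hy' : s + s * σ (τ y) - τ y * restrict C y - τ y + σ (τ y) - restrict C y = 0 := by
      have h := sub_eq_zero.2 hy
      rw [← h]
      simp only [T]
      abel
    have hσA : σ (τ y) * A = A * τ y := by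
      simp only [σ]
      rw [mul_assoc, hA'A, mul_one]
    have h1 : (1 + s) * A * (1 + τ y) = (1 + s) * (1 + σ (τ y)) * A := by
      rw [mul_assoc (1 + s), mul_assoc (1 + s), add_mul 1 (σ (τ y)), hσA, mul_add, mul_one, one_mul]
    rw [hFs, h1, ← mul_assoc]
    congr 1
    rw [← sub_eq_zero, ← hy']
    noncomm_ring

end Conjugation

/-! ### Sums without cancellation -/

section Peel

variable {Γ K : Type*} [Group Γ] [LinearOrder Γ] [MulLeftStrictMono Γ] [MulRightStrictMono Γ]
  [Field K]

theorem coeff_sum_mul_mul {ι : Type*} (s : Finset ι) (b q : ι → HahnSeries Γ K)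
    (η : HahnSeries Γ K) (m : Γ) :
    (∑ i ∈ s, b i * η * q i).coeff m =
      ∑ᶠ c, (η * ∑ i ∈ s, (b i).coeff c • q i).coeff (c⁻¹ * m) := by
  rw [HahnSeries.coeff_sum]
  simp_rw [Finset.mul_sum, HahnSeries.coeff_sum, mul_smul_comm, HahnSeries.coeff_smul, smul_eq_mul]
  rw [finsum_sum_comm]
  · exact Finset.sum_congr rfl fun i _ => by rw [mul_assoc, coeff_mul]
  · exact fun i _ => finite_support_mul (b i) (η * q i) m

/-- Let the `b i` be supported in `C`. For `c` in `C` let `Q c` be the sum of the `q i` weighted by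
the coefficients of the `b i` at `c`. Then `∑ b i * η * q i` is the formal sum of the `c * η * Q c`.
The leading exponents `c * lead η * lead (Q c)` of the latter are distinct, so that the first one
of them is the leading exponent of the whole sum. -/
theorem lead_sum_mul_mul {ι : Type*} (s : Finset ι) {C : Subgroup Γ} (b q : ι → HahnSeries Γ K)
    (hb : ∀ i ∈ s, (b i).support ⊆ C) {η : HahnSeries Γ K} (hη : η ≠ 0)
    (hfree : ∀ c c' v v', c ∈ C → c' ∈ C → AltWord C (lead η) v → AltWord C (lead η) v' →
      c * lead η * v = c' * lead η * v' → c = c')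
    (hq : ∀ c, ∑ i ∈ s, (b i).coeff c • q i ≠ 0 →
      AltWord C (lead η) (lead (∑ i ∈ s, (b i).coeff c • q i))) :
    (∑ i ∈ s, b i * η * q i = 0 ∨ ∃ c ∈ C, ∃ v, AltWord C (lead η) v ∧
      lead (∑ i ∈ s, b i * η * q i) = c * lead η * v) ∧
    ∀ c, ∑ i ∈ s, (b i).coeff c • q i ≠ 0 → ∑ i ∈ s, b i * η * q i ≠ 0 ∧
      lead (∑ i ∈ s, b i * η * q i) ≤ c * lead η * lead (∑ i ∈ s, (b i).coeff c • q i) := by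
  set y := ∑ i ∈ s, b i * η * q i with hy
  set Q : Γ → HahnSeries Γ K := fun c => ∑ i ∈ s, (b i).coeff c • q i with hQ
  have hcoeff : ∀ m, y.coeff m = ∑ᶠ c, (η * Q c).coeff (c⁻¹ * m) := coeff_sum_mul_mul s b q η
  have hex : ∀ c, Q c ≠ 0 → ∃ i ∈ s, (b i).coeff c ≠ 0 := by
    intro c hc
    by_contra h
    push Not at h
    exact hc (Finset.sum_eq_zero fun i hi => by rw [h i hi, zero_smul])
  have hQC : ∀ c, Q c ≠ 0 → c ∈ C := by
    intro c hc
    obtain ⟨i, hi, h⟩ := hex c hc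
    exact hb i hi h
  have hlow : ∀ c g, g < c * lead η * lead (Q c) → (η * Q c).coeff (c⁻¹ * g) = 0 := by
    intro c g hg
    refine coeff_mul_eq_zero_of_lt (fun a => coeff_eq_zero_of_lt_lead)
      (fun a => coeff_eq_zero_of_lt_lead) ?_
    rw [inv_mul_lt_iff_lt_mul, ← mul_assoc]
    exact hg
  set S : Set Γ := {m | ∃ c, Q c ≠ 0 ∧ m = c * lead η * lead (Q c)} with hS
  have hSwf : S.IsWF := by
    have h1 : (⋃ i ∈ s, (b i).support).IsPWO :=
      (Finset.isPWO_bUnion s).2 fun i _ => (b i).isPWO_support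
    have h2 : (⋃ i ∈ s, (q i).support).IsPWO :=
      (Finset.isPWO_bUnion s).2 fun i _ => (q i).isPWO_support
    refine (((isPWO_image_mul (isPWO_image_mul h1 (Set.isPWO_singleton (lead η))) h2)).mono
      ?_).isWF
    rintro _ ⟨c, hc, rfl⟩
    obtain ⟨i, hi, hbi⟩ := hex c hc
    have hlq : ∃ j ∈ s, (q j).coeff (lead (Q c)) ≠ 0 := by
      by_contra h
      push Not at h
      apply coeff_lead_ne_zero hc
      simp only [hQ]
      rw [HahnSeries.coeff_sum]
      refine Finset.sum_eq_zero fun j hj => ?_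
      have := h j hj
      simp only [hQ] at this
      rw [HahnSeries.coeff_smul, this, smul_zero]
    obtain ⟨j, hj, hqj⟩ := hlq
    refine ⟨(c * lead η, lead (Q c)), ⟨⟨(c, lead η), ⟨?_, rfl⟩, rfl⟩, ?_⟩, rfl⟩
    · simp only [Set.mem_iUnion]
      exact ⟨i, hi, hbi⟩
    · simp only [Set.mem_iUnion]
      exact ⟨j, hj, hqj⟩
  by_cases hne : S.Nonempty
  · obtain ⟨c₀, hc₀, hm⟩ := hSwf.min_mem hne
    set m := hSwf.min hne with hmdef
    have hmin : ∀ c, Q c ≠ 0 → m ≤ c * lead η * lead (Q c) := fun c hc =>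
      hSwf.min_le hne ⟨c, hc, rfl⟩
    have hzero : ∀ g < m, y.coeff g = 0 := by
      intro g hg
      rw [hcoeff]
      refine finsum_eq_zero_of_forall_eq_zero fun c => ?_
      by_cases hc : Q c = 0
      · rw [hc, mul_zero]; rfl
      · exact hlow c g (hg.trans_le (hmin c hc))
    have hym : y.coeff m ≠ 0 := by
      rw [hcoeff, finsum_eq_single _ c₀]
      · have : c₀⁻¹ * m = lead η * lead (Q c₀) := by rw [hm]; group
        rw [this, coeff_mul_lead]
        exact mul_ne_zero (coeff_lead_ne_zero hη) (coeff_lead_ne_zero hc₀)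
      · intro c hc
        by_cases hc0 : Q c = 0
        · rw [hc0, mul_zero]; rfl
        · refine hlow c m (lt_of_le_of_ne (hmin c hc0) fun h => hc ?_)
          exact hfree c c₀ _ _ (hQC c hc0) (hQC c₀ hc₀) (hq c hc0) (hq c₀ hc₀) (h.symm.trans hm)
    have hlead : lead y = m := lead_eq_of hym hzero
    refine ⟨Or.inr ⟨c₀, hQC c₀ hc₀, _, hq c₀ hc₀, hlead.trans hm⟩, fun c hc => ?_⟩
    exact ⟨ne_zero_of_coeff hym, hlead ▸ hmin c hc⟩
  · have hall : ∀ c, Q c = 0 := fun c => by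
      by_contra hc
      exact hne ⟨_, c, hc, rfl⟩
    refine ⟨Or.inl ?_, fun c hc => absurd (hall c) hc⟩
    ext m
    rw [hcoeff]
    exact finsum_eq_zero_of_forall_eq_zero fun c => by rw [hall c, mul_zero]; rfl

end Peel

/-! ### Words in two letters -/

section Words

/-- The value of a word in two letters when `o` is replaced by `y` and the other letter by `x`. -/
def wordEval {R : Type*} [Monoid R] (o : Fin 2) (x y : R) (z : List (Fin 2)) : R :=
  (z.map fun e => if e = o then y else x).prod

theorem wordEval_cons {R : Type*} [Monoid R] (o : Fin 2) (x y : R) (e : Fin 2) (z : List (Fin 2)) :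
    wordEval o x y (e :: z) = (if e = o then y else x) * wordEval o x y z := by
  simp [wordEval]

theorem wordEval_replicate {R : Type*} [Monoid R] {ξ o : Fin 2} (h : ξ ≠ o) (x y : R) (i : ℕ) :
    wordEval o x y (List.replicate i ξ) = x ^ i := by
  simp [wordEval, h]

/-- Expansion of a word in `x` and `y + η` according to the first occurrence of `η`. -/
theorem wordEval_add {R : Type*} [Ring R] (o : Fin 2) (x y η : R) (z : List (Fin 2)) :
    wordEval o x (y + η) z = wordEval o x y z +
      ∑ i ∈ Finset.range z.length, if z[i]? = some o then
        wordEval o x y (z.take i) * η * wordEval o x (y + η) (z.drop (i + 1)) else 0 := by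
  induction z with
  | nil => simp [wordEval]
  | cons e z ih =>
    rw [wordEval_cons, wordEval_cons, List.length_cons, Finset.sum_range_succ']
    have h1 : ∀ i, (if (e :: z)[i + 1]? = some o then
        wordEval o x y ((e :: z).take (i + 1)) * η *
          wordEval o x (y + η) ((e :: z).drop (i + 1 + 1)) else 0) =
        (if e = o then y else x) * (if z[i]? = some o then
        wordEval o x y (z.take i) * η * wordEval o x (y + η) (z.drop (i + 1)) else 0) := by
      intro i
      rw [List.getElem?_cons_succ, List.take_succ_cons, List.drop_succ_cons, wordEval_cons]
      split_ifs <;> simp [mul_assoc]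
    simp_rw [h1]
    rw [← Finset.mul_sum]
    have h2 : wordEval o x y [] = 1 := rfl
    have h3 : ∀ w : R, (if e = o then y + η else x) * w =
        (if e = o then y else x) * w + if e = o then η * w else 0 := by
      intro w
      split_ifs
      · rw [add_mul]
      · rw [add_zero]
    rw [h3]
    conv_lhs => arg 1; rw [ih]
    simp [h2, mul_add, add_assoc]

/-- The weight of a word in which the letter `o` has weight `B` and the other letter has
weight `A`. -/
def wordWeight (o : Fin 2) (A B : ℤ) (z : List (Fin 2)) : ℤ :=
  (z.map fun e => if e = o then B else A).sum

theorem wordWeight_append (o : Fin 2) (A B : ℤ) (z z' : List (Fin 2)) :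
    wordWeight o A B (z ++ z') = wordWeight o A B z + wordWeight o A B z' := by
  simp [wordWeight]

theorem wordWeight_cons_self (o : Fin 2) (A B : ℤ) (z : List (Fin 2)) :
    wordWeight o A B (o :: z) = B + wordWeight o A B z := by
  simp [wordWeight]

theorem wordWeight_replicate {ξ o : Fin 2} (h : ξ ≠ o) (A B : ℤ) (i : ℕ) :
    wordWeight o A B (List.replicate i ξ) = i * A := by
  simp [wordWeight, h]

theorem wordWeight_nonneg (o : Fin 2) {A B : ℤ} (hA : 0 < A) (hB : 0 < B) (z : List (Fin 2)) :
    0 ≤ wordWeight o A B z := by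
  refine List.sum_nonneg fun x hx => ?_
  obtain ⟨e, -, rfl⟩ := List.mem_map.1 hx
  split_ifs <;> omega

theorem eq_or_eq_of_ne {ξ o : Fin 2} (h : ξ ≠ o) (e : Fin 2) : e = ξ ∨ e = o := by
  omega

theorem eq_replicate_of_count_eq_zero {ξ o : Fin 2} (h : ξ ≠ o) {z : List (Fin 2)}
    (hz : z.count o = 0) : ∃ i, z = List.replicate i ξ := by
  refine ⟨z.length, List.eq_replicate_iff.2 ⟨rfl, fun e he => ?_⟩⟩
  rcases eq_or_eq_of_ne h e with h' | h'
  · exact h'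
  · subst h'
    exact absurd (List.count_pos_iff.2 he) (by omega)

/-- A word either avoids `o` or splits at the first occurrence of `o`. -/
theorem exists_eq_replicate_append {ξ o : Fin 2} (h : ξ ≠ o) (z : List (Fin 2)) :
    ∃ i, z = List.replicate i ξ ∨ ∃ z₁, z = List.replicate i ξ ++ o :: z₁ := by
  induction z with
  | nil => exact ⟨0, Or.inl rfl⟩
  | cons e z ih =>
    rcases eq_or_eq_of_ne h e with rfl | rfl
    · obtain ⟨i, rfl | ⟨z₁, rfl⟩⟩ := ih
      · exact ⟨i + 1, Or.inl rfl⟩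
      · exact ⟨i + 1, Or.inr ⟨z₁, rfl⟩⟩
    · exact ⟨0, Or.inr ⟨z, rfl⟩⟩

theorem count_replicate_of_ne {ξ o : Fin 2} (h : ξ ≠ o) (i : ℕ) :
    (List.replicate i ξ).count o = 0 := by
  rw [List.count_replicate]
  simp [h]

end Words

/-! ### Expansion of a polynomial at the first occurrence of `η` -/

section Cofactor

variable {Γ K : Type*} [Group Γ] [LinearOrder Γ] [MulLeftStrictMono Γ] [MulRightStrictMono Γ]
  [Field K]

/-- The value of a noncommutative polynomial, given by its coefficients, when `o` is replaced by `y`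
and the other letter by `x`. -/
noncomputable def polyEval (o : Fin 2) (x y : HahnSeries Γ K) :
    (List (Fin 2) →₀ K) →ₗ[K] HahnSeries Γ K :=
  Finsupp.linearCombination K (wordEval o x y)

theorem polyEval_apply (o : Fin 2) (x y : HahnSeries Γ K) (P : List (Fin 2) →₀ K) :
    polyEval o x y P = ∑ z ∈ P.support, P z • wordEval o x y z := rfl

/-- The occurrences of the letter `o` in the words of the support of `P`. -/
noncomputable def occurrences (o : Fin 2) (P : List (Fin 2) →₀ K) :
    Finset (Σ _ : List (Fin 2), ℕ) :=
  (P.support.sigma fun z => Finset.range z.length).filter fun p => p.1[p.2]? = some o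

/-- The sum of the `z₁` over the factorizations `z₀ * o * z₁` of the words of `P`, weighted by the
coefficient of the word in `P` and the coefficient of `z₀(φ, γ)` at `c`. -/
noncomputable def cofactor (o : Fin 2) (φ γ : HahnSeries Γ K) (c : Γ) (P : List (Fin 2) →₀ K) :
    List (Fin 2) →₀ K :=
  ∑ p ∈ occurrences o P, Finsupp.single (p.1.drop (p.2 + 1))
    ((P p.1 • wordEval o φ γ (p.1.take p.2)).coeff c)

theorem polyEval_cofactor (o : Fin 2) (φ γ x y : HahnSeries Γ K) (c : Γ) (P : List (Fin 2) →₀ K) :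
    polyEval o x y (cofactor o φ γ c P) =
      ∑ p ∈ occurrences o P, ((P p.1 • wordEval o φ γ (p.1.take p.2)).coeff c) •
        wordEval o x y (p.1.drop (p.2 + 1)) := by
  rw [cofactor, map_sum]
  refine Finset.sum_congr rfl fun p _ => ?_
  rw [polyEval, Finsupp.linearCombination_single]

theorem polyEval_add (o : Fin 2) (φ γ η : HahnSeries Γ K) (P : List (Fin 2) →₀ K) :
    polyEval o φ (γ + η) P = polyEval o φ γ P +
      ∑ p ∈ occurrences o P, (P p.1 • wordEval o φ γ (p.1.take p.2)) * η *
        wordEval o φ (γ + η) (p.1.drop (p.2 + 1)) := by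
  rw [polyEval_apply, polyEval_apply, occurrences, Finset.sum_filter, Finset.sum_sigma,
    ← Finset.sum_add_distrib]
  refine Finset.sum_congr rfl fun z _ => ?_
  rw [wordEval_add, smul_add, Finset.smul_sum]
  congr 1
  refine Finset.sum_congr rfl fun i _ => ?_
  simp only
  split_ifs
  · simp
  · simp

theorem mem_occurrences {o : Fin 2} {P : List (Fin 2) →₀ K} {p : Σ _ : List (Fin 2), ℕ}
    (hp : p ∈ occurrences o P) :
    P p.1 ≠ 0 ∧ p.1 = p.1.take p.2 ++ o :: p.1.drop (p.2 + 1) ∧ p.2 < p.1.length := by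
  obtain ⟨z, i⟩ := p
  simp only [occurrences, Finset.mem_filter, Finset.mem_sigma, Finsupp.mem_support_iff,
    Finset.mem_range] at hp ⊢
  obtain ⟨⟨h1, h2⟩, h3⟩ := hp
  refine ⟨h1, ?_, h2⟩
  obtain ⟨_, h4⟩ := List.getElem?_eq_some_iff.1 h3
  conv_lhs => rw [← List.take_append_drop i z, List.drop_eq_getElem_cons h2, h4]

theorem mem_occurrences_of {o : Fin 2} {P : List (Fin 2) →₀ K} {z₀ z₁ : List (Fin 2)}
    (h : P (z₀ ++ o :: z₁) ≠ 0) : (⟨z₀ ++ o :: z₁, z₀.length⟩ : Σ _ : List (Fin 2), ℕ) ∈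
      occurrences o P := by
  simp [occurrences, h]

theorem exists_of_cofactor_ne_zero {o : Fin 2} {φ γ : HahnSeries Γ K} {c : Γ}
    {P : List (Fin 2) →₀ K} {z₁ : List (Fin 2)} (h : cofactor o φ γ c P z₁ ≠ 0) :
    ∃ z₀, P (z₀ ++ o :: z₁) ≠ 0 ∧ (wordEval o φ γ z₀).coeff c ≠ 0 := by
  rw [cofactor, Finsupp.finsetSum_apply] at h
  obtain ⟨p, hp, hne⟩ := Finset.exists_ne_zero_of_sum_ne_zero h
  rw [Finsupp.single_apply] at hne
  split_ifs at hne with h1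
  · obtain ⟨h2, h3, -⟩ := mem_occurrences hp
    refine ⟨p.1.take p.2, ?_, ?_⟩
    · rw [← h1, ← h3]; exact h2
    · rw [HahnSeries.coeff_smul] at hne
      exact right_ne_zero_of_mul hne
  · exact absurd rfl hne

/-- If a single word `z₀ * o * z₁` contributes to the coefficient of the cofactor at `z₁`, then this
coefficient does not vanish. -/
theorem cofactor_apply_ne_zero {o : Fin 2} {φ γ : HahnSeries Γ K} {c : Γ}
    {P : List (Fin 2) →₀ K} {z₀ z₁ : List (Fin 2)} (hP : P (z₀ ++ o :: z₁) ≠ 0)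
    (hc : (wordEval o φ γ z₀).coeff c ≠ 0)
    (huniq : ∀ z, P (z ++ o :: z₁) ≠ 0 → (wordEval o φ γ z).coeff c ≠ 0 → z = z₀) :
    cofactor o φ γ c P z₁ ≠ 0 := by
  rw [cofactor, Finsupp.finsetSum_apply,
    Finset.sum_eq_single_of_mem _ (mem_occurrences_of hP)]
  · simp only [List.take_left']
    rw [show (z₀ ++ o :: z₁).drop (z₀.length + 1) = z₁ by simp, Finsupp.single_eq_same,
      HahnSeries.coeff_smul]
    exact mul_ne_zero hP hc
  · intro p hp hne
    rw [Finsupp.single_apply]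
    split_ifs with h1
    · obtain ⟨h2, h3, h4⟩ := mem_occurrences hp
      by_contra h5
      rw [HahnSeries.coeff_smul] at h5
      have h6 := right_ne_zero_of_mul h5
      rw [h1] at h3
      have h7 := huniq _ (h3 ▸ h2) h6
      apply hne
      rw [h7] at h3
      have h8 : p.2 = z₀.length := by
        rw [← h7, List.length_take]
        omega
      exact Sigma.ext h3 (heq_of_eq h8)
    · rfl

theorem length_lt_of_cofactor {o : Fin 2} {φ γ : HahnSeries Γ K} {c : Γ}
    {P : List (Fin 2) →₀ K} {N : ℕ} (hN : ∀ z, P z ≠ 0 → z.length < N + 1) {z₁ : List (Fin 2)}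
    (h : cofactor o φ γ c P z₁ ≠ 0) : z₁.length < N := by
  obtain ⟨z₀, h1, -⟩ := exists_of_cofactor_ne_zero h
  have := hN _ h1
  simp at this
  omega

/-- The hypotheses under which the leading exponents of polynomials in `φ` and `γ + η` are
understood: `φ` and `γ` are supported in the subgroup `C`, and the leading exponent of `η` is free
from `C`, in the sense of the last two fields. -/
structure FreeOver (C : Subgroup Γ) (φ γ η : HahnSeries Γ K) : Prop where
  support_φ : φ.support ⊆ C
  support_γ : γ.support ⊆ C
  ne_zero : η ≠ 0
  left_unique : ∀ c c' v v', c ∈ C → c' ∈ C → AltWord C (lead η) v → AltWord C (lead η) v' →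
    c * lead η * v = c' * lead η * v' → c = c'
  step_notMem : ∀ c v, c ∈ C → AltWord C (lead η) v → c * lead η * v ∉ C

theorem support_wordEval {C : Subgroup Γ} (o : Fin 2) {x y : HahnSeries Γ K}
    (hx : x.support ⊆ C) (hy : y.support ⊆ C) (z : List (Fin 2)) :
    (wordEval o x y z).support ⊆ C := by
  induction z with
  | nil => exact support_one_subset C
  | cons e z ih =>
    rw [wordEval_cons]
    refine support_mul_subset_subgroup ?_ ih
    split_ifs
    · exact hy
    · exact hx

theorem support_polyEval {C : Subgroup Γ} (o : Fin 2) {x y : HahnSeries Γ K}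
    (hx : x.support ⊆ C) (hy : y.support ⊆ C) (P : List (Fin 2) →₀ K) :
    (polyEval o x y P).support ⊆ C := by
  intro g hg
  by_contra h
  apply hg
  rw [polyEval_apply, HahnSeries.coeff_sum]
  refine Finset.sum_eq_zero fun z _ => ?_
  rw [HahnSeries.coeff_smul, coeff_eq_zero_of_support (support_wordEval o hx hy z) h, smul_zero]

/-- The leading exponent of `P(φ, γ + η)` is the first one among those of `P(φ, γ)` and of the
`c * η * Q`, where `Q` is the value of the cofactor of `P` at `c`. -/
theorem lead_polyEval {C : Subgroup Γ} {φ γ η : HahnSeries Γ K} (H : FreeOver C φ γ η) (o : Fin 2)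
    (P : List (Fin 2) →₀ K)
    (IH : ∀ c, cofactor o φ γ c P ≠ 0 → polyEval o φ (γ + η) (cofactor o φ γ c P) ≠ 0 ∧
      AltWord C (lead η) (lead (polyEval o φ (γ + η) (cofactor o φ γ c P)))) :
    (polyEval o φ (γ + η) P ≠ 0 → AltWord C (lead η) (lead (polyEval o φ (γ + η) P))) ∧
    (polyEval o φ γ P ≠ 0 → polyEval o φ (γ + η) P ≠ 0 ∧
      lead (polyEval o φ (γ + η) P) ≤ lead (polyEval o φ γ P)) ∧
    ∀ c, cofactor o φ γ c P ≠ 0 → polyEval o φ (γ + η) P ≠ 0 ∧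
      lead (polyEval o φ (γ + η) P) ≤
        c * lead η * lead (polyEval o φ (γ + η) (cofactor o φ γ c P)) := by
  have hpeel := lead_sum_mul_mul (occurrences o P) (C := C)
    (fun p => P p.1 • wordEval o φ γ (p.1.take p.2))
    (fun p => wordEval o φ (γ + η) (p.1.drop (p.2 + 1))) (by
      intro p _ g hg
      apply support_wordEval o H.support_φ H.support_γ (p.1.take p.2)
      intro h
      apply hg
      rw [HahnSeries.coeff_smul, h, smul_zero]) H.ne_zero H.left_unique (by
      intro c hc
      rw [← polyEval_cofactor] at hc ⊢
      refine (IH c fun h => hc ?_).2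
      rw [h, map_zero])
  simp_rw [← polyEval_cofactor] at hpeel
  have hadd := polyEval_add o φ γ η P
  set y := ∑ p ∈ occurrences o P, (P p.1 • wordEval o φ γ (p.1.take p.2)) * η *
        wordEval o φ (γ + η) (p.1.drop (p.2 + 1)) with hy
  set E₀ := polyEval o φ γ P with hE₀
  obtain ⟨hy1, hy2⟩ := hpeel
  have hE₀C : E₀ ≠ 0 → lead E₀ ∈ C := fun h =>
    support_polyEval o H.support_φ H.support_γ P (coeff_lead_ne_zero h)
  have hyC : y ≠ 0 → ∃ c ∈ C, ∃ v, AltWord C (lead η) v ∧ lead y = c * lead η * v := by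
    intro h
    rcases hy1 with h' | h'
    · exact absurd h' h
    · exact h'
  -- the leading exponents of the two summands are different
  have hmain : (E₀ ≠ 0 ∧ y = 0) ∨ (E₀ = 0) ∨ (E₀ ≠ 0 ∧ y ≠ 0 ∧ lead E₀ < lead y) ∨
      (E₀ ≠ 0 ∧ y ≠ 0 ∧ lead y < lead E₀) := by
    by_cases h1 : E₀ = 0
    · exact Or.inr (Or.inl h1)
    by_cases h2 : y = 0
    · exact Or.inl ⟨h1, h2⟩
    rcases lt_trichotomy (lead E₀) (lead y) with h | h | h
    · exact Or.inr (Or.inr (Or.inl ⟨h1, h2, h⟩))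
    · obtain ⟨c, hc, v, hv, h'⟩ := hyC h2
      exact absurd (hE₀C h1) (by rw [h, h']; exact H.step_notMem c v hc hv)
    · exact Or.inr (Or.inr (Or.inr ⟨h1, h2, h⟩))
  rw [hadd]
  have hyAlt : y ≠ 0 → AltWord C (lead η) (lead y) := by
    intro h
    obtain ⟨c, hc, v, hv, h'⟩ := hyC h
    rw [h']
    exact .step hc hv
  have hy3 : ∀ c, cofactor o φ γ c P ≠ 0 → y ≠ 0 ∧
      lead y ≤ c * lead η * lead (polyEval o φ (γ + η) (cofactor o φ γ c P)) :=
    fun c hc => hy2 c (IH c hc).1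
  rcases hmain with ⟨h1, h2⟩ | h1 | ⟨h1, h2, h3⟩ | ⟨h1, h2, h3⟩
  · rw [h2, add_zero]
    exact ⟨fun _ => .base (hE₀C h1), fun _ => ⟨h1, le_rfl⟩, fun c hc => absurd h2 (hy3 c hc).1⟩
  · rw [h1, zero_add]
    exact ⟨hyAlt, fun h => absurd rfl h, hy3⟩
  · obtain ⟨h4, h5⟩ := lead_add_of_lt h1 (Or.inr h3)
    rw [h5]
    exact ⟨fun _ => .base (hE₀C h1), fun _ => ⟨h4, le_rfl⟩,
      fun c hc => ⟨h4, h3.le.trans (hy3 c hc).2⟩⟩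
  · obtain ⟨h4, h5⟩ := lead_add_of_lt h2 (Or.inr h3)
    rw [add_comm] at h4 h5
    rw [h5]
    exact ⟨fun _ => hyAlt h2, fun _ => ⟨h4, h3.le⟩, fun c hc => ⟨h4, (hy3 c hc).2⟩⟩

end Cofactor

/-! ### The degree estimate for series -/

section TopWords

variable {K : Type*} [Field K]

/-- `z` has the largest weight among the words of `P`, and the largest number of letters `o` among
the words of that weight. -/
def IsTop (o : Fin 2) (A B : ℤ) (P : List (Fin 2) →₀ K) (z : List (Fin 2)) : Prop :=
  P z ≠ 0 ∧ ∀ z', P z' ≠ 0 → wordWeight o A B z' ≤ wordWeight o A B z ∧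
    (wordWeight o A B z' = wordWeight o A B z → z'.count o ≤ z.count o)

theorem exists_isTop (o : Fin 2) (A B : ℤ) {P : List (Fin 2) →₀ K} (hP : P ≠ 0) :
    ∃ z, IsTop o A B P z := by
  obtain ⟨z₁, h1, h2⟩ := P.support.exists_max_image (wordWeight o A B)
    (Finsupp.support_nonempty_iff.2 hP)
  obtain ⟨z, h3, h4⟩ := (P.support.filter fun z => wordWeight o A B z =
    wordWeight o A B z₁).exists_max_image (List.count o) ⟨z₁, by simp [h1]⟩
  rw [Finset.mem_filter] at h3
  refine ⟨z, Finsupp.mem_support_iff.1 h3.1, fun z' hz' => ?_⟩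
  have hz'' := Finsupp.mem_support_iff.2 hz'
  exact ⟨(h2 z' hz'').trans h3.2.ge, fun h =>
    h4 z' (Finset.mem_filter.2 ⟨hz'', h.trans h3.2⟩)⟩

theorem IsTop.of_le {o : Fin 2} {A B : ℤ} {P : List (Fin 2) →₀ K} {z z' : List (Fin 2)}
    (h : IsTop o A B P z) (hz' : P z' ≠ 0) (hw : wordWeight o A B z ≤ wordWeight o A B z')
    (hc : z.count o ≤ z'.count o) : IsTop o A B P z' := by
  refine ⟨hz', fun y hy => ?_⟩
  obtain ⟨h1, h2⟩ := h.2 y hy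
  have h3 := (h.2 z' hz').1
  exact ⟨by omega, fun h4 => (h2 (by omega)).trans hc⟩

end TopWords

section Bound

variable {Γ K : Type*} [Group Γ] [LinearOrder Γ] [Field K]

/-- The degree `d` is a homomorphism to `ℤ` that decreases along the order, `A` is the degree of the
leading exponent of `φ`, and `B` bounds the degrees of the exponents of `γ`. -/
structure DegreeData (d : Γ → ℤ) (φ γ : HahnSeries Γ K) (A B : ℤ) : Prop where
  map_mul : ∀ a b, d (a * b) = d a + d b
  antitone : ∀ a b, a ≤ b → d b ≤ d a
  ne_zero : φ ≠ 0
  lead_eq : d (lead φ) = A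
  pos_left : 0 < A
  pos_right : 0 < B
  le_of_coeff : ∀ g, γ.coeff g ≠ 0 → d g ≤ B

namespace DegreeData

variable {d : Γ → ℤ} {φ γ η : HahnSeries Γ K} {A B : ℤ} {o ξ : Fin 2}

theorem map_one (D : DegreeData d φ γ A B) : d 1 = 0 := by
  have := D.map_mul 1 1
  rw [mul_one] at this
  omega

theorem map_pow (D : DegreeData d φ γ A B) (a : Γ) (i : ℕ) : d (a ^ i) = i * d a := by
  induction i with
  | zero => simp [D.map_one]
  | succ i ih => rw [pow_succ, D.map_mul, ih]; push_cast; ring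

theorem eq_replicate_of_weight (D : DegreeData d φ γ A B) (hξ : ξ ≠ o) {z : List (Fin 2)} {i : ℕ}
    (hc : z.count o = 0) (hw : wordWeight o A B z = i * A) : z = List.replicate i ξ := by
  obtain ⟨l, rfl⟩ := eq_replicate_of_count_eq_zero hξ hc
  rw [wordWeight_replicate hξ] at hw
  have := mul_right_cancel₀ D.pos_left.ne' hw
  rw [show l = i by exact_mod_cast this]

/-- As `A` does not divide `B`, a word of weight `B + l * A` with at most one `o` has exactly one. -/
theorem eq_cons_replicate (D : DegreeData d φ γ A B) (hξ : ξ ≠ o) (hAB : ¬ A ∣ B)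
    {z : List (Fin 2)} {l : ℕ} (hw : wordWeight o A B z = B + l * A) (hc : z.count o ≤ 1)
    (hstart : z.count o = 1 → ∃ z', z = o :: z') : z = o :: List.replicate l ξ := by
  by_cases h0 : z.count o = 0
  · obtain ⟨i, rfl⟩ := eq_replicate_of_count_eq_zero hξ h0
    rw [wordWeight_replicate hξ] at hw
    exact absurd ⟨(i : ℤ) - l, by linear_combination -hw⟩ hAB
  · obtain ⟨z', rfl⟩ := hstart (by omega)
    rw [wordWeight_cons_self] at hw
    rw [List.count_cons_self] at hc
    rw [D.eq_replicate_of_weight hξ (z := z') (i := l) (by omega) (by omega)]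

variable [MulLeftStrictMono Γ] [MulRightStrictMono Γ]

/-- The degree of a word in `φ` and `γ` is at most its weight. -/
theorem le_wordWeight (D : DegreeData d φ γ A B) {z : List (Fin 2)} {g : Γ}
    (h : (wordEval o φ γ z).coeff g ≠ 0) : d g ≤ wordWeight o A B z := by
  induction z generalizing g with
  | nil =>
    by_cases hg : g = 1
    · rw [hg, D.map_one]; rfl
    · exact absurd (HahnSeries.coeff_single_of_ne hg) h
  | cons e z ih =>
    rw [wordEval_cons, coeff_mul] at h
    obtain ⟨a, ha⟩ : ∃ a, (if e = o then γ else φ).coeff a *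
        (wordEval o φ γ z).coeff (a⁻¹ * g) ≠ 0 := by
      by_contra hn
      push Not at hn
      exact h (finsum_eq_zero_of_forall_eq_zero hn)
    have h1 := ih (right_ne_zero_of_mul ha)
    have h2 := left_ne_zero_of_mul ha
    have h3 : d g = d a + d (a⁻¹ * g) := by rw [← D.map_mul]; group
    have h4 : wordWeight o A B (e :: z) = (if e = o then B else A) + wordWeight o A B z := by
      simp [wordWeight]
    rw [h3, h4]
    refine add_le_add ?_ h1
    split_ifs at h2 ⊢ with h5
    · exact D.le_of_coeff a h2
    · rw [← D.lead_eq]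
      exact D.antitone _ _ (lead_le h2)

theorem pow_ne_zero_and_lead (D : DegreeData d φ γ A B) (i : ℕ) :
    φ ^ i ≠ 0 ∧ lead (φ ^ i) = lead φ ^ i := by
  induction i with
  | zero =>
    have h : (1 : HahnSeries Γ K).coeff 1 ≠ 0 := by
      rw [one_def, HahnSeries.coeff_single_same]; exact one_ne_zero
    rw [pow_zero, pow_zero]
    exact ⟨ne_zero_of_coeff h, lead_eq_of h fun g hg => by
      rw [one_def, HahnSeries.coeff_single_of_ne hg.ne]⟩
  | succ i ih =>
    obtain ⟨h1, h2⟩ := lead_mul ih.1 D.ne_zero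
    rw [pow_succ, pow_succ]
    exact ⟨h1, by rw [h2, ih.2]⟩

theorem coeff_wordEval_replicate (D : DegreeData d φ γ A B) (hξ : ξ ≠ o) (i : ℕ) :
    (wordEval o φ γ (List.replicate i ξ)).coeff (lead φ ^ i) ≠ 0 := by
  rw [wordEval_replicate hξ]
  obtain ⟨h1, h2⟩ := D.pow_ne_zero_and_lead i
  rw [← h2]
  exact coeff_lead_ne_zero h1

theorem coeff_polyEval_ne_zero {P : List (Fin 2) →₀ K} {x y : HahnSeries Γ K} {c : Γ}
    {z₀ : List (Fin 2)} (hP : P z₀ ≠ 0) (hc : (wordEval o x y z₀).coeff c ≠ 0)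
    (huniq : ∀ z, P z ≠ 0 → (wordEval o x y z).coeff c ≠ 0 → z = z₀) :
    (polyEval o x y P).coeff c ≠ 0 := by
  rw [polyEval_apply, HahnSeries.coeff_sum,
    Finset.sum_eq_single_of_mem z₀ (Finsupp.mem_support_iff.2 hP)]
  · rw [HahnSeries.coeff_smul]
    exact mul_ne_zero hP hc
  · intro z hz hne
    rw [HahnSeries.coeff_smul]
    by_contra h
    exact hne (huniq z (Finsupp.mem_support_iff.1 hz) (right_ne_zero_of_mul h))

/-- If a top word avoids `o`, then its leading exponent survives in `P(φ, γ)`. -/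
theorem coeff_of_isTop_replicate (D : DegreeData d φ γ A B) (hξ : ξ ≠ o)
    {P : List (Fin 2) →₀ K} {i : ℕ} (ht : IsTop o A B P (List.replicate i ξ)) :
    (polyEval o φ γ P).coeff (lead φ ^ i) ≠ 0 := by
  refine coeff_polyEval_ne_zero ht.1 (D.coeff_wordEval_replicate hξ i) fun z hz hc => ?_
  obtain ⟨h1, h2⟩ := ht.2 z hz
  have h3 := D.le_wordWeight hc
  rw [D.map_pow, D.lead_eq] at h3
  rw [wordWeight_replicate hξ] at h1 h2
  have h4 := h2 (by omega)
  rw [count_replicate_of_ne hξ] at h4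
  exact D.eq_replicate_of_weight hξ (by omega) (by omega)

/-- If a top word is `ξ ^ i * o * z₁`, then `z₁` survives in the cofactor at the `i`-th power of the
leading exponent of `φ`. -/
theorem cofactor_of_isTop (D : DegreeData d φ γ A B) (hξ : ξ ≠ o)
    {P : List (Fin 2) →₀ K} {i : ℕ} {z₁ : List (Fin 2)}
    (ht : IsTop o A B P (List.replicate i ξ ++ o :: z₁)) :
    cofactor o φ γ (lead φ ^ i) P z₁ ≠ 0 := by
  refine cofactor_apply_ne_zero ht.1 (D.coeff_wordEval_replicate hξ i) fun z hz hc => ?_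
  obtain ⟨h1, h2⟩ := ht.2 _ hz
  have h3 := D.le_wordWeight hc
  rw [D.map_pow, D.lead_eq] at h3
  simp only [wordWeight_append, wordWeight_replicate hξ, List.count_append,
    count_replicate_of_ne hξ] at h1 h2
  have h4 := h2 (by omega)
  exact D.eq_replicate_of_weight hξ (by omega) (by omega)

/-- Polynomials in `φ` and `γ + η` do not vanish, and their leading exponents are alternating
words. -/
theorem polyEval_ne_zero (D : DegreeData d φ γ A B) (hξ : ξ ≠ o) {C : Subgroup Γ}
    (H : FreeOver C φ γ η) {P : List (Fin 2) →₀ K} (hP : P ≠ 0) :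
    polyEval o φ (γ + η) P ≠ 0 ∧ AltWord C (lead η) (lead (polyEval o φ (γ + η) P)) := by
  obtain ⟨N, hN⟩ : ∃ N, ∀ z, P z ≠ 0 → z.length < N :=
    ⟨P.support.sup List.length + 1, fun z hz =>
      Nat.lt_succ_of_le (Finset.le_sup (f := List.length) (Finsupp.mem_support_iff.2 hz))⟩
  induction N generalizing P with
  | zero =>
    refine absurd (Finsupp.ext fun z => ?_) hP
    by_contra h
    exact absurd (hN z h) (by omega)
  | succ N ih =>
    obtain ⟨h1, h2, h3⟩ := lead_polyEval H o P fun c hc =>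
      ih hc fun z hz => length_lt_of_cofactor hN hz
    suffices h : polyEval o φ (γ + η) P ≠ 0 from ⟨h, h1 h⟩
    obtain ⟨z, hz⟩ := exists_isTop o A B hP
    obtain ⟨i, rfl | ⟨z₁, rfl⟩⟩ := exists_eq_replicate_append hξ z
    · exact (h2 (ne_zero_of_coeff (D.coeff_of_isTop_replicate hξ hz))).1
    · refine (h3 (lead φ ^ i) fun h => D.cofactor_of_isTop hξ hz ?_).1
      rw [h]; rfl

/-- The terms of `P(φ, γ)` bound the degree of `P(φ, γ + η)` from below. -/
theorem le_lead_of_coeff (D : DegreeData d φ γ A B) (hξ : ξ ≠ o) {C : Subgroup Γ}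
    (H : FreeOver C φ γ η) {P : List (Fin 2) →₀ K} {c : Γ} (hc : (polyEval o φ γ P).coeff c ≠ 0) :
    d c ≤ d (lead (polyEval o φ (γ + η) P)) :=
  D.antitone _ _ ((((lead_polyEval H o P fun _ => D.polyEval_ne_zero hξ H).2.1
    (ne_zero_of_coeff hc)).2).trans (lead_le hc))

/-- The cofactors of `P` bound the degree of `P(φ, γ + η)` from below. -/
theorem le_lead_of_cofactor (D : DegreeData d φ γ A B) (hξ : ξ ≠ o) {C : Subgroup Γ}
    (H : FreeOver C φ γ η) {P : List (Fin 2) →₀ K} {c : Γ} (hc : cofactor o φ γ c P ≠ 0) :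
    d c + d (lead η) + d (lead (polyEval o φ (γ + η) (cofactor o φ γ c P))) ≤
      d (lead (polyEval o φ (γ + η) P)) := by
  rw [← D.map_mul, ← D.map_mul]
  exact D.antitone _ _ ((lead_polyEval H o P fun _ => D.polyEval_ne_zero hξ H).2.2 c hc).2

theorem wordWeight_le_of_cofactor (D : DegreeData d φ γ A B) {P : List (Fin 2) →₀ K} {c : Γ}
    {W : ℤ} (hW : ∀ z, P z ≠ 0 → wordWeight o A B z ≤ W) {z₁ : List (Fin 2)}
    (h : cofactor o φ γ c P z₁ ≠ 0) : d c + B + wordWeight o A B z₁ ≤ W := by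
  obtain ⟨z₀, h1, h2⟩ := exists_of_cofactor_ne_zero h
  have h3 := hW _ h1
  have h4 := D.le_wordWeight h2
  rw [wordWeight_append, wordWeight_cons_self] at h3
  omega

theorem coeff_wordEval_cons_replicate (D : DegreeData d φ γ A B) (hξ : ξ ≠ o) (hγ : γ ≠ 0)
    (l : ℕ) : (wordEval o φ γ (o :: List.replicate l ξ)).coeff (lead γ * lead φ ^ l) ≠ 0 := by
  rw [wordEval_cons, if_pos rfl, wordEval_replicate hξ]
  obtain ⟨h1, h2⟩ := D.pow_ne_zero_and_lead l
  obtain ⟨h3, h4⟩ := lead_mul hγ h1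
  rw [← h2, ← h4]
  exact coeff_lead_ne_zero h3

/-- The degree estimate: a polynomial of weight `W` has degree at least `W - j * (B - δ)`, where
`δ` is the degree of `η` and `j` is at most `W / (A + B)`. -/
theorem weight_le_lead (D : DegreeData d φ γ A B) (hξ : ξ ≠ o) {C : Subgroup Γ}
    (H : FreeOver C φ γ η)
    (hcase : d (lead η) = B ∨ γ ≠ 0 ∧ d (lead γ) = B ∧ A ≤ B ∧ ¬ A ∣ B)
    {P : List (Fin 2) →₀ K} {W : ℤ} (hW : ∀ z, P z ≠ 0 → wordWeight o A B z ≤ W)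
    (hW' : ∃ z, P z ≠ 0 ∧ wordWeight o A B z = W) :
    ∃ j : ℕ, j * (A + B) ≤ W ∧
      W - j * (B - d (lead η)) ≤ d (lead (polyEval o φ (γ + η) P)) := by
  have hA := D.pos_left
  have hB := D.pos_right
  obtain ⟨N, hN⟩ : ∃ N, ∀ z, P z ≠ 0 → z.length < N :=
    ⟨P.support.sup List.length + 1, fun z hz =>
      Nat.lt_succ_of_le (Finset.le_sup (f := List.length) (Finsupp.mem_support_iff.2 hz))⟩
  induction N generalizing P W with
  | zero =>
    obtain ⟨z, hz, -⟩ := hW'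
    exact absurd (hN z hz) (by omega)
  | succ N ih =>
    have hP : P ≠ 0 := by
      rintro rfl
      obtain ⟨z, hz, -⟩ := hW'
      exact hz rfl
    have hW0 : 0 ≤ W := by
      obtain ⟨z, -, rfl⟩ := hW'
      exact wordWeight_nonneg o hA hB z
    have hWtop : ∀ z, IsTop o A B P z → wordWeight o A B z = W := by
      intro z hz
      obtain ⟨z', h1, rfl⟩ := hW'
      exact le_antisymm (hW z hz.1) (hz.2 z' h1).1
    -- a nonzero coefficient of `P(φ, γ)` in degree `W` leaves nothing to prove
    have hzero : ∀ c, (polyEval o φ γ P).coeff c ≠ 0 → d c = W → ∃ j : ℕ, j * (A + B) ≤ W ∧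
        W - j * (B - d (lead η)) ≤ d (lead (polyEval o φ (γ + η) P)) := by
      intro c hc hd
      refine ⟨0, by simpa using hW0, ?_⟩
      have := D.le_lead_of_coeff hξ H hc
      simp only [Nat.cast_zero, zero_mul, sub_zero]
      omega
    -- passing to a cofactor loses `B - δ`
    have hstep : ∀ c z₁, cofactor o φ γ c P z₁ ≠ 0 → d c + B + wordWeight o A B z₁ = W →
        (A ≤ d c ∨ d (lead η) = B) → ∃ j : ℕ, j * (A + B) ≤ W ∧
        W - j * (B - d (lead η)) ≤ d (lead (polyEval o φ (γ + η) P)) := by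
      intro c z₁ hc hw hs
      have hc0 : cofactor o φ γ c P ≠ 0 := by
        intro h
        rw [h] at hc
        exact hc rfl
      obtain ⟨j, h1, h2⟩ := ih (P := cofactor o φ γ c P) (W := wordWeight o A B z₁)
        (fun z hz => by have := D.wordWeight_le_of_cofactor hW hz; omega) ⟨z₁, hc, rfl⟩
        (fun z hz => length_lt_of_cofactor hN hz)
      have h3 := D.le_lead_of_cofactor hξ H hc0
      rcases hs with hs | hs
      · refine ⟨j + 1, ?_, ?_⟩
        · push_cast
          linarith
        · push_cast
          linarith
      · refine ⟨0, by simpa using hW0, ?_⟩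
        rw [hs, sub_self, mul_zero] at h2
        simp only [Nat.cast_zero, zero_mul, sub_zero]
        omega
    by_cases hξtop : ∃ i, IsTop o A B P (List.replicate i ξ)
    · obtain ⟨i, hi⟩ := hξtop
      refine hzero _ (D.coeff_of_isTop_replicate hξ hi) ?_
      rw [← hWtop _ hi, wordWeight_replicate hξ, D.map_pow, D.lead_eq]
    by_cases hpos : ∃ i z₁, IsTop o A B P (List.replicate i ξ ++ o :: z₁) ∧
        (1 ≤ i ∨ d (lead η) = B)
    · obtain ⟨i, z₁, ht, hi⟩ := hpos
      refine hstep _ z₁ (D.cofactor_of_isTop hξ ht) ?_ ?_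
      · rw [← hWtop _ ht, wordWeight_append, wordWeight_replicate hξ, wordWeight_cons_self,
          D.map_pow, D.lead_eq]
        ring
      · refine hi.imp_left fun hi => ?_
        rw [D.map_pow, D.lead_eq]
        have : (1 : ℤ) ≤ i := by exact_mod_cast hi
        nlinarith
    -- now all top words start with `o`
    have hstart : ∀ z, IsTop o A B P z → ∃ z', z = o :: z' := by
      intro z hz
      obtain ⟨i, rfl | ⟨z₁, rfl⟩⟩ := exists_eq_replicate_append hξ z
      · exact absurd ⟨i, hz⟩ hξtop
      · obtain rfl : i = 0 := by
          by_contra h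
          exact hpos ⟨i, z₁, hz, Or.inl (by omega)⟩
        exact ⟨z₁, rfl⟩
    obtain ⟨z, hz⟩ := exists_isTop o A B hP
    obtain ⟨z', rfl⟩ := hstart z hz
    have hδB : d (lead η) ≠ B := fun h => hpos ⟨0, z', hz, Or.inr h⟩
    obtain ⟨hγ, hb, hle, hdvd⟩ := hcase.resolve_left hδB
    have hdeg : ∀ l : ℕ, d (lead γ * lead φ ^ l) = B + l * A := fun l => by
      rw [D.map_mul, D.map_pow, D.lead_eq, hb]
    obtain ⟨l, rfl | ⟨z₂, rfl⟩⟩ := exists_eq_replicate_append hξ z'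
    · refine hzero _ (coeff_polyEval_ne_zero hz.1 (D.coeff_wordEval_cons_replicate hξ hγ l)
        fun y hy hc => ?_) ?_
      · obtain ⟨h1, h2⟩ := hz.2 y hy
        have h3 := D.le_wordWeight hc
        have h4 := hWtop _ hz
        rw [hdeg] at h3
        rw [wordWeight_cons_self, wordWeight_replicate hξ] at h1 h2
        rw [List.count_cons_self, count_replicate_of_ne hξ] at h2
        refine D.eq_cons_replicate hξ hdvd (by omega) (h2 (by omega)) fun h5 => ?_
        refine hstart y (hz.of_le hy ?_ ?_)
        · rw [wordWeight_cons_self, wordWeight_replicate hξ]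
          exact h3
        · rw [List.count_cons_self, count_replicate_of_ne hξ]
          omega
      · rw [hdeg, ← hWtop _ hz, wordWeight_cons_self, wordWeight_replicate hξ]
    · refine hstep _ z₂ (cofactor_apply_ne_zero (z₀ := o :: List.replicate l ξ) hz.1
        (D.coeff_wordEval_cons_replicate hξ hγ l) fun y hy hc => ?_) ?_ (Or.inl ?_)
      · obtain ⟨h1, h2⟩ := hz.2 _ hy
        have h3 := D.le_wordWeight hc
        rw [hdeg] at h3
        simp only [wordWeight_append, wordWeight_cons_self, wordWeight_replicate hξ] at h1 h2
        simp only [List.count_append, List.count_cons_self, count_replicate_of_ne hξ] at h2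
        have h4 := h2 (by omega)
        refine D.eq_cons_replicate hξ hdvd (by omega) (by omega) fun h5 => ?_
        obtain ⟨w, hw⟩ := hstart _ (hz.of_le hy (by
          simp only [wordWeight_append, wordWeight_cons_self, wordWeight_replicate hξ]
          omega) (by
          simp only [List.count_append, List.count_cons_self, count_replicate_of_ne hξ]
          omega))
        cases y with
        | nil => simp at h5
        | cons e y =>
          rw [List.cons_append] at hw
          rw [(List.cons.inj hw).1]
          exact ⟨y, rfl⟩
      · rw [hdeg, ← hWtop _ hz, wordWeight_cons_self, wordWeight_append, wordWeight_replicate hξ,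
          wordWeight_cons_self]
        ring
      · rw [hdeg]
        nlinarith [Int.natCast_nonneg l]

end DegreeData

end Bound

/-! ### The free algebra in the Malcev–Neumann ring -/

section FreeAlgebraWords

variable {K X : Type*} [Field K]

theorem lift_eq_sum {R : Type*} [Ring R] [Algebra K R] (v : X → R) (f : FreeAlgebra K X) :
    FreeAlgebra.lift K v f =
      ∑ u ∈ supp f, (FreeAlgebra.equivMonoidAlgebraFreeMonoid f).coeff u • FreeMonoid.lift v u := by
  have h : (FreeAlgebra.lift K v).comp
      (FreeAlgebra.equivMonoidAlgebraFreeMonoid (R := K) (X := X)).symm.toAlgHom =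
      MonoidAlgebra.lift K R (FreeMonoid X) (FreeMonoid.lift v) := by
    refine MonoidAlgebra.algHom_ext' ?_ (by ext)
    ext x
    simp [FreeAlgebra.equivMonoidAlgebraFreeMonoid]
  have h' := DFunLike.congr_fun h (FreeAlgebra.equivMonoidAlgebraFreeMonoid f)
  rw [MonoidAlgebra.lift_apply] at h'
  simpa [Finsupp.sum, supp] using h'

theorem supp_nonempty {f : FreeAlgebra K X} (hf : f ≠ 0) : (supp f).Nonempty := by
  rw [supp, Finsupp.support_nonempty_iff, Ne, MonoidAlgebra.coeff_eq_zero]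
  exact fun h => hf ((map_eq_zero_iff _ (AlgEquiv.injective _)).1 h)

theorem mem_supp {f : FreeAlgebra K X} {u : FreeMonoid X} :
    u ∈ supp f ↔ (FreeAlgebra.equivMonoidAlgebraFreeMonoid f).coeff u ≠ 0 :=
  Finsupp.mem_support_iff

theorem exists_wdeg_eq (w : X → ℕ) {f : FreeAlgebra K X} (hf : f ≠ 0) :
    ∃ u ∈ supp f, (u.toList.map w).sum = wdeg w f := by
  obtain ⟨u, hu, h⟩ := Finset.exists_mem_eq_sup (supp f) (supp_nonempty hf)
    fun u => (u.toList.map w).sum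
  exact ⟨u, hu, h.symm⟩

theorem le_wdeg (w : X → ℕ) {f : FreeAlgebra K X} {u : FreeMonoid X} (hu : u ∈ supp f) :
    (u.toList.map w).sum ≤ wdeg w f :=
  Finset.le_sup (f := fun u : FreeMonoid X => (u.toList.map w).sum) hu

theorem supp_neg (f : FreeAlgebra K X) : supp (-f) = supp f := by
  ext u
  rw [mem_supp, mem_supp, map_neg, MonoidAlgebra.coeff_neg, Finsupp.neg_apply, neg_ne_zero]

theorem deg_neg (f : FreeAlgebra K X) : deg (-f) = deg f := by
  rw [deg, deg, wdeg, wdeg, supp_neg]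

theorem toFreeGroup_of (x : X) : toFreeGroup (FreeMonoid.of x) = FreeGroup.of x := by
  simp [toFreeGroup]

theorem toFreeGroup_mul (u v : FreeMonoid X) :
    toFreeGroup (u * v) = toFreeGroup u * toFreeGroup v := by
  simp [toFreeGroup]

theorem groupDeg_mul (a b : FreeGroup X) : groupDeg (a * b) = groupDeg a + groupDeg b := by
  simp [groupDeg]

theorem groupDeg_of (x : X) : groupDeg (FreeGroup.of x) = 1 := by
  simp [groupDeg]

theorem groupDeg_toFreeGroup (u : FreeMonoid X) :
    groupDeg (toFreeGroup u) = ((u.toList.map fun _ => (1 : ℕ)).sum : ℕ) := by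
  induction u using FreeMonoid.inductionOn' with
  | one => simp [toFreeGroup, groupDeg]
  | of_mul x u ih =>
    rw [toFreeGroup_mul, groupDeg_mul, ih, toFreeGroup_of, groupDeg_of]
    simp

theorem toFreeGroup_eq_mk (u : FreeMonoid X) :
    toFreeGroup u = FreeGroup.mk (u.toList.map fun x => (x, true)) := by
  induction u using FreeMonoid.inductionOn' with
  | one => simp [toFreeGroup, FreeGroup.one_eq_mk]
  | of_mul x u ih =>
    rw [toFreeGroup_mul, ih, toFreeGroup_of, FreeGroup.of, FreeGroup.mul_mk]
    simp

theorem toFreeGroup_injective : Function.Injective (toFreeGroup : FreeMonoid X → FreeGroup X) := by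
  classical
  have h : ∀ u : FreeMonoid X,
      (toFreeGroup u).toWord = u.toList.map fun x => (x, true) := by
    intro u
    rw [toFreeGroup_eq_mk, FreeGroup.toWord_mk, FreeGroup.IsReduced.reduce_eq]
    generalize u.toList = l
    refine List.IsChain.imp (R := fun a b : X × Bool => a.2 = b.2) (fun a b h _ => h) ?_
    refine List.Pairwise.isChain ?_
    refine List.pairwise_of_forall_mem_list fun a ha b hb => ?_
    simp only [List.mem_map] at ha hb
    obtain ⟨x, -, rfl⟩ := ha
    obtain ⟨y, -, rfl⟩ := hb
    rfl
  intro u v huv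
  have h1 := h u
  rw [huv, h v] at h1
  exact FreeMonoid.toList.injective
    (List.map_injective_iff.2 (fun a b hab => (Prod.mk.inj hab).1) h1).symm

end FreeAlgebraWords

section Coefficients

variable {K : Type*} [Field K]

/-- The coefficients of a noncommutative polynomial in two variables, indexed by lists. -/
noncomputable def listCoeff (P : FreeAlgebra K (Fin 2)) : List (Fin 2) →₀ K :=
  (FreeAlgebra.equivMonoidAlgebraFreeMonoid P).coeff.equivMapDomain FreeMonoid.toList

theorem listCoeff_ne_zero_iff {P : FreeAlgebra K (Fin 2)} {z : List (Fin 2)} :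
    listCoeff P z ≠ 0 ↔ FreeMonoid.ofList z ∈ supp P := by
  rw [listCoeff, Finsupp.equivMapDomain_apply, mem_supp]
  rfl

theorem listCoeff_ne_zero {P : FreeAlgebra K (Fin 2)} (hP : P ≠ 0) : listCoeff P ≠ 0 := by
  obtain ⟨u, hu⟩ := supp_nonempty hP
  intro h
  have h' : listCoeff P u.toList ≠ 0 := listCoeff_ne_zero_iff.2 hu
  rw [h] at h'
  exact h' rfl

theorem sum_map_eq_wordWeight {ξ o : Fin 2} (h : ξ ≠ o) (w : Fin 2 → ℕ) (z : List (Fin 2)) :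
    ((z.map w).sum : ℤ) = wordWeight o (w ξ) (w o) z := by
  induction z with
  | nil => rfl
  | cons e z ih =>
    have h1 : wordWeight o (w ξ) (w o) (e :: z) = (if e = o then (w o : ℤ) else w ξ) +
        wordWeight o (w ξ) (w o) z := by
      simp [wordWeight]
    rw [h1, ← ih, List.map_cons, List.sum_cons, Nat.cast_add]
    rcases eq_or_eq_of_ne h e with rfl | rfl
    · rw [if_neg h]
    · rw [if_pos rfl]

theorem wordEval_eq_prod {R : Type*} [Monoid R] {ξ o : Fin 2} (h : ξ ≠ o) (v : Fin 2 → R)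
    (z : List (Fin 2)) : wordEval o (v ξ) (v o) z = (z.map v).prod := by
  rw [wordEval]
  congr 1
  refine List.map_congr_left fun e _ => ?_
  rcases eq_or_eq_of_ne h e with rfl | rfl
  · rw [if_neg h]
  · rw [if_pos rfl]

variable {Γ : Type*} [Group Γ] [LinearOrder Γ] [MulLeftStrictMono Γ] [MulRightStrictMono Γ]

theorem lift_eq_polyEval {ξ o : Fin 2} (h : ξ ≠ o) (v : Fin 2 → HahnSeries Γ K)
    (P : FreeAlgebra K (Fin 2)) :
    FreeAlgebra.lift K v P = polyEval o (v ξ) (v o) (listCoeff P) := by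
  rw [lift_eq_sum, polyEval, listCoeff, Finsupp.linearCombination_equivMapDomain,
    Finsupp.linearCombination_apply, Finsupp.sum, supp]
  refine Finset.sum_congr rfl fun u _ => ?_
  rw [Function.comp_apply, wordEval_eq_prod h, FreeMonoid.lift_apply]

end Coefficients

section ToSeries

variable {K X : Type*} [Field K] [LinearOrder (FreeGroup X)] [MulLeftStrictMono (FreeGroup X)]
  [MulRightStrictMono (FreeGroup X)]

/-- The embedding of the free algebra in the ring of series over the free group. -/
noncomputable def toSeries : FreeAlgebra K X →ₐ[K] HahnSeries (FreeGroup X) K :=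
  FreeAlgebra.lift K fun x => HahnSeries.single (FreeGroup.of x) 1

theorem toSeries_eq_sum (f : FreeAlgebra K X) : toSeries f = ∑ u ∈ supp f,
    (FreeAlgebra.equivMonoidAlgebraFreeMonoid f).coeff u •
      HahnSeries.single (toFreeGroup u) 1 := by
  rw [toSeries, lift_eq_sum]
  refine Finset.sum_congr rfl fun u hu => ?_
  congr 1
  clear hu
  induction u using FreeMonoid.inductionOn' with
  | one => rw [map_one, one_def]; simp [toFreeGroup]
  | of_mul x u ih =>
    rw [map_mul, ih, FreeMonoid.lift_eval_of, single_mul_single, toFreeGroup_mul, toFreeGroup_of,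
      one_mul]

theorem coeff_toSeries (f : FreeAlgebra K X) (u : FreeMonoid X) :
    (toSeries f).coeff (toFreeGroup u) = (FreeAlgebra.equivMonoidAlgebraFreeMonoid f).coeff u := by
  rw [toSeries_eq_sum, HahnSeries.coeff_sum]
  have h : ∀ u', u' ≠ u → ((FreeAlgebra.equivMonoidAlgebraFreeMonoid f).coeff u' •
      HahnSeries.single (toFreeGroup u') (1 : K)).coeff (toFreeGroup u) = 0 := by
    intro u' hu'
    rw [HahnSeries.coeff_smul, HahnSeries.coeff_single_of_ne, smul_zero]
    exact fun h => hu' (toFreeGroup_injective h).symm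
  rw [Finset.sum_eq_single u (fun u' _ => h u')]
  · rw [HahnSeries.coeff_smul, HahnSeries.coeff_single_same, smul_eq_mul, mul_one]
  · intro hu
    rw [mem_supp, not_not] at hu
    rw [hu, zero_smul, HahnSeries.coeff_zero]

theorem exists_of_coeff_toSeries {f : FreeAlgebra K X} {g : FreeGroup X}
    (hg : (toSeries f).coeff g ≠ 0) : ∃ u ∈ supp f, toFreeGroup u = g := by
  rw [toSeries_eq_sum, HahnSeries.coeff_sum] at hg
  obtain ⟨u, hu, h⟩ := Finset.exists_ne_zero_of_sum_ne_zero hg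
  refine ⟨u, hu, ?_⟩
  by_contra hne
  rw [HahnSeries.coeff_smul, HahnSeries.coeff_single_of_ne (Ne.symm hne), smul_zero] at h
  exact h rfl

theorem toSeries_ne_zero {f : FreeAlgebra K X} (hf : f ≠ 0) : toSeries f ≠ 0 := by
  obtain ⟨u, hu⟩ := supp_nonempty hf
  exact ne_zero_of_coeff (g := toFreeGroup u) (by rwa [coeff_toSeries, ← mem_supp])

theorem toSeries_injective :
    Function.Injective (toSeries : FreeAlgebra K X → HahnSeries (FreeGroup X) K) :=
  (injective_iff_map_eq_zero _).2 fun f hf => by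
    by_contra h
    exact toSeries_ne_zero h hf

theorem groupDeg_lead_toSeries (hd : ∀ a b : FreeGroup X, a ≤ b → groupDeg b ≤ groupDeg a)
    {f : FreeAlgebra K X} (hf : f ≠ 0) : groupDeg (lead (toSeries f)) = deg f := by
  apply le_antisymm
  · obtain ⟨u, hu, h⟩ := exists_of_coeff_toSeries (coeff_lead_ne_zero (toSeries_ne_zero hf))
    rw [← h, groupDeg_toFreeGroup]
    exact Nat.cast_le.2 (le_wdeg _ hu)
  · obtain ⟨u, hu, h⟩ := exists_wdeg_eq (fun _ => 1) hf
    rw [deg, ← h]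
    refine le_trans ?_ (hd _ (toFreeGroup u) (lead_le ?_))
    · rw [groupDeg_toFreeGroup]
    · rwa [coeff_toSeries, ← mem_supp]

end ToSeries

/-! ### The degree estimate in the free algebra -/

section Conjugate

theorem wordEval_conj {R : Type*} [Monoid R] (o : Fin 2) {x y x' y' c : R} (hx : x * c = c * x')
    (hy : y * c = c * y') (z : List (Fin 2)) : wordEval o x y z * c = c * wordEval o x' y' z := by
  induction z with
  | nil => simp [wordEval]
  | cons e z ih =>
    rw [wordEval_cons, wordEval_cons, mul_assoc, ih]
    split_ifs
    · rw [← mul_assoc, hy, mul_assoc]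
    · rw [← mul_assoc, hx, mul_assoc]

theorem commutator_conj {R : Type*} [Ring R] {x y x' y' c : R} (hx : x * c = c * x')
    (hy : y * c = c * y') : (x * y - y * x) * c = c * (x' * y' - y' * x') := by
  rw [sub_mul, mul_sub, mul_assoc x, hy, ← mul_assoc x, hx, mul_assoc y, hx, ← mul_assoc y, hy,
    mul_assoc c, mul_assoc c]

variable {Γ K : Type*} [Group Γ] [LinearOrder Γ] [Field K]

theorem one_add_ne_zero_and_lead {t : HahnSeries Γ K} (ht : t.support ⊆ Set.Ioi 1) :
    1 + t ≠ 0 ∧ lead (1 + t) = 1 := by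
  have h : (1 : HahnSeries Γ K).coeff 1 ≠ 0 := by
    rw [one_def, HahnSeries.coeff_single_same]; exact one_ne_zero
  have h1 : lead (1 : HahnSeries Γ K) = 1 := lead_eq_of h fun g hg => by
    rw [one_def, HahnSeries.coeff_single_of_ne hg.ne]
  obtain ⟨h2, h3⟩ := lead_add_of_lt (y := t) (ne_zero_of_coeff h) (by
    by_cases h0 : t = 0
    · exact Or.inl h0
    · rw [h1]
      exact Or.inr (ht (coeff_lead_ne_zero h0)))
  exact ⟨h2, h3.trans h1⟩

variable [MulLeftStrictMono Γ] [MulRightStrictMono Γ]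

theorem polyEval_conj (o : Fin 2) {x y x' y' c : HahnSeries Γ K} (hx : x * c = c * x')
    (hy : y * c = c * y') (P : List (Fin 2) →₀ K) :
    polyEval o x y P * c = c * polyEval o x' y' P := by
  rw [polyEval_apply, polyEval_apply, Finset.sum_mul, Finset.mul_sum]
  refine Finset.sum_congr rfl fun z _ => ?_
  rw [smul_mul_assoc, wordEval_conj o hx hy, mul_smul_comm]

/-- Conjugate series have the same leading exponent. -/
theorem lead_of_conj {x y t : HahnSeries Γ K} (ht : t.support ⊆ Set.Ioi 1)
    (h : x * (1 + t) = (1 + t) * y) (hx : x ≠ 0) : y ≠ 0 ∧ lead y = lead x := by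
  obtain ⟨h1, h2⟩ := one_add_ne_zero_and_lead ht
  obtain ⟨h3, h4⟩ := lead_mul hx h1
  have hy : y ≠ 0 := by
    rintro rfl
    rw [h, mul_zero] at h3
    exact h3 rfl
  obtain ⟨-, h5⟩ := lead_mul h1 hy
  rw [h, h5, h2, one_mul, mul_one] at h4
  exact ⟨hy, h4⟩

/-- The leading exponent of a commutator is one of the two products of the leading exponents,
when these products differ. -/
theorem lead_commutator {x y : HahnSeries Γ K} (hx : x ≠ 0) (hy : y ≠ 0)
    (h : lead x * lead y ≠ lead y * lead x) :
    lead (x * y - y * x) = lead x * lead y ∨ lead (x * y - y * x) = lead y * lead x := by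
  obtain ⟨h1, h2⟩ := lead_mul hx hy
  obtain ⟨h3, h4⟩ := lead_mul hy hx
  have h5 : -(y * x) ≠ 0 := neg_ne_zero.2 h3
  rw [sub_eq_add_neg]
  rcases lt_or_gt_of_ne h with h | h
  · left
    rw [← h2]
    exact (lead_add_of_lt h1 (Or.inr (by rwa [lead_neg, h2, h4]))).2
  · right
    rw [add_comm, ← h4, ← lead_neg (y * x)]
    exact (lead_add_of_lt h5 (Or.inr (by rwa [lead_neg, h2, h4]))).2

end Conjugate

section NormalForm

variable {X K : Type*} [LinearOrder (FreeGroup X)] [Field K]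

theorem freeOver_centralizer {a : FreeGroup X} {φ γ η : HahnSeries (FreeGroup X) K}
    (hφ : φ.support ⊆ Subgroup.centralizer {a}) (hγ : γ.support ⊆ Subgroup.centralizer {a})
    (hη : η ≠ 0) (h : a * lead η ≠ lead η * a) :
    FreeOver (Subgroup.centralizer {a}) φ γ η where
  support_φ := hφ
  support_γ := hγ
  ne_zero := hη
  left_unique _ _ _ _ hc hc' hv hv' heq := AltWord.left_unique h hc hc' hv hv' heq
  step_notMem _ _ hc hv := AltWord.step_notMem h hc hv

variable [MulLeftStrictMono (FreeGroup X)] [MulRightStrictMono (FreeGroup X)]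

/-- Two series that do not commute are simultaneously conjugate to series `φ` and `γ + η`, where
`φ` and `γ` are supported in the centralizer of the leading exponent of `φ`, and `η` off it. -/
theorem exists_normalForm {F G : HahnSeries (FreeGroup X) K} (hF : F ≠ 0) (hF1 : lead F ≠ 1)
    (hFG : F * G ≠ G * F) :
    ∃ t φ γ η : HahnSeries (FreeGroup X) K, t.support ⊆ Set.Ioi 1 ∧
      φ.support ⊆ Subgroup.centralizer {lead F} ∧
      γ.support ⊆ Subgroup.centralizer {lead F} ∧
      (∀ g ∈ Subgroup.centralizer {lead F}, η.coeff g = 0) ∧ η ≠ 0 ∧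
      F * (1 + t) = (1 + t) * φ ∧ G * (1 + t) = (1 + t) * (γ + η) ∧ φ * γ = γ * φ := by
  obtain ⟨t, φ, ht, hφ, h1⟩ := exists_conj_centralizer F hF
  obtain ⟨G', h2⟩ := exists_one_add_mul_eq ht (G * (1 + t))
  set C := Subgroup.centralizer {lead F} with hC
  have hcomm : ∀ a ∈ C, ∀ b ∈ C, a * b = b * a := by
    obtain ⟨u, hu⟩ := centralizer_eq_zpowers (lead F) hF1
    rw [hC, hu]
    rintro _ ⟨i, rfl⟩ _ ⟨j, rfl⟩
    exact (Commute.refl u).zpow_zpow i j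
  have hadd : restrict C G' + restrict (C : Set (FreeGroup X))ᶜ G' = G' := by
    ext g
    rw [HahnSeries.coeff_add]
    by_cases hg : g ∈ (C : Set (FreeGroup X))
    · rw [coeff_restrict_of_mem hg, coeff_restrict_of_notMem (Set.notMem_compl_iff.2 hg), add_zero]
    · rw [coeff_restrict_of_notMem hg, coeff_restrict_of_mem (Set.mem_compl hg), zero_add]
  have hγ := support_restrict_subset (C : Set (FreeGroup X)) G'
  have hφγ := mul_comm_of_support hcomm hφ hγ
  refine ⟨t, φ, _, _, ht, hφ, hγ,
    fun g hg => coeff_restrict_of_notMem (Set.notMem_compl_iff.2 hg) G', ?_, h1,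
    by rw [hadd, h2], hφγ⟩
  intro hη
  rw [hη, add_zero] at hadd
  rw [hadd] at hφγ
  -- otherwise `F` and `G` commute, being conjugate to elements that do
  apply hFG
  have h3 : (F * G - G * F) * (1 + t) = 0 := by
    rw [commutator_conj h1 h2.symm, hφγ, sub_self, mul_zero]
  by_contra h4
  exact (lead_mul (sub_ne_zero.2 h4) (one_add_ne_zero_and_lead ht).1).1 h3

end NormalForm

section DegreeEstimate

variable {X K : Type*} [LinearOrder (FreeGroup X)] [MulLeftStrictMono (FreeGroup X)]
  [MulRightStrictMono (FreeGroup X)] [Field K]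

theorem toSeries_lift {ξ o : Fin 2} (h : ξ ≠ o) (v : Fin 2 → FreeAlgebra K X)
    (P : FreeAlgebra K (Fin 2)) : toSeries (FreeAlgebra.lift K v P) =
      polyEval o (toSeries (v ξ)) (toSeries (v o)) (listCoeff P) := by
  rw [← lift_eq_polyEval h (fun e => toSeries (v e))]
  have : toSeries.comp (FreeAlgebra.lift K v) = FreeAlgebra.lift K fun e => toSeries (v e) := by
    ext e
    simp
  exact DFunLike.congr_fun this P

/-- The degree estimate, for a substitution in which `ξ` has the smaller degree. -/
theorem wdeg_mul_deg_commutator_le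
    (hd : ∀ a b : FreeGroup X, a ≤ b → groupDeg b ≤ groupDeg a) {ξ o : Fin 2} (h : ξ ≠ o)
    {v : Fin 2 → FreeAlgebra K X} (hpos : 0 < deg (v ξ)) (hle : deg (v ξ) ≤ deg (v o))
    (hdvd : ¬ deg (v ξ) ∣ deg (v o)) (hcomm : v ξ * v o ≠ v o * v ξ)
    {P : FreeAlgebra K (Fin 2)} (hP : P ≠ 0) :
    wdeg (fun e => deg (v e)) P * deg (v ξ * v o - v o * v ξ) ≤
      deg (FreeAlgebra.lift K v P) * (deg (v ξ) + deg (v o)) := by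
  have hξ0 : v ξ ≠ 0 := by
    intro h0
    rw [h0, zero_mul, mul_zero] at hcomm
    exact hcomm rfl
  have ho0 : v o ≠ 0 := by
    intro h0
    rw [h0, zero_mul, mul_zero] at hcomm
    exact hcomm rfl
  set F := toSeries (v ξ) with hF
  set G := toSeries (v o) with hG
  have hF0 : F ≠ 0 := toSeries_ne_zero hξ0
  have hG0 : G ≠ 0 := toSeries_ne_zero ho0
  have hFd : groupDeg (lead F) = deg (v ξ) := groupDeg_lead_toSeries hd hξ0
  have hGd : groupDeg (lead G) = deg (v o) := groupDeg_lead_toSeries hd ho0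
  have hF1 : lead F ≠ 1 := by
    intro h1
    rw [h1] at hFd
    have : groupDeg (1 : FreeGroup X) = 0 := by simp [groupDeg]
    omega
  have hFG : F * G ≠ G * F := by
    intro h1
    apply hcomm
    apply toSeries_injective
    rw [map_mul, map_mul]
    exact h1
  obtain ⟨t, φ, γ, η, ht, hφ, hγ, hη, hη0, h1, h2, h3⟩ := exists_normalForm hF0 hF1 hFG
  obtain ⟨hφ0, hφl⟩ := lead_of_conj ht h1 hF0
  obtain ⟨hγη0, hγηl⟩ := lead_of_conj ht h2 hG0
  have hlη : lead η ∉ Subgroup.centralizer {lead F} := fun hm => coeff_lead_ne_zero hη0 (hη _ hm)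
  have hne : lead F * lead η ≠ lead η * lead F := by
    intro h4
    refine hlη (Subgroup.mem_centralizer_iff.2 ?_)
    rintro _ rfl
    exact h4
  have H := freeOver_centralizer hφ hγ hη0 hne
  -- coefficients of the two parts are coefficients of their sum
  have hγc : ∀ g, γ.coeff g ≠ 0 → (γ + η).coeff g = γ.coeff g := fun g hg => by
    rw [HahnSeries.coeff_add, hη g (hγ hg), add_zero]
  have hηc : ∀ g, g ∉ Subgroup.centralizer {lead F} → (γ + η).coeff g = η.coeff g :=
    fun g hg => by
      rw [HahnSeries.coeff_add, coeff_eq_zero_of_support hγ hg, zero_add]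
  have hbound : ∀ g, (γ + η).coeff g ≠ 0 → groupDeg g ≤ deg (v o) := fun g hg => by
    rw [← hGd, ← hγηl]
    exact hd _ _ (lead_le hg)
  have D : DegreeData groupDeg φ γ (deg (v ξ)) (deg (v o)) := {
    map_mul := groupDeg_mul
    antitone := hd
    ne_zero := hφ0
    lead_eq := by rw [hφl, hFd]
    pos_left := by exact_mod_cast hpos
    pos_right := by exact_mod_cast hpos.trans_le hle
    le_of_coeff := fun g hg => hbound g (by rwa [hγc g hg]) }
  have hδ : groupDeg (lead η) ≤ deg (v o) :=
    hbound _ (by rw [hηc _ hlη]; exact coeff_lead_ne_zero hη0)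
  have hcase : groupDeg (lead η) = deg (v o) ∨ γ ≠ 0 ∧ groupDeg (lead γ) = deg (v o) ∧
      (deg (v ξ) : ℤ) ≤ deg (v o) ∧ ¬ (deg (v ξ) : ℤ) ∣ deg (v o) := by
    have h4 := coeff_lead_ne_zero hγη0
    by_cases hm : lead (γ + η) ∈ Subgroup.centralizer {lead F}
    · rw [HahnSeries.coeff_add, hη _ hm, add_zero] at h4
      refine Or.inr ⟨ne_zero_of_coeff h4, le_antisymm ?_ ?_, by exact_mod_cast hle,
        by exact_mod_cast hdvd⟩
      · have h5 := coeff_lead_ne_zero (ne_zero_of_coeff h4)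
        exact hbound _ (by rwa [hγc _ h5])
      · rw [← hGd, ← hγηl]
        exact hd _ _ (lead_le h4)
    · rw [hηc _ hm] at h4
      refine Or.inl (le_antisymm hδ ?_)
      rw [← hGd, ← hγηl]
      exact hd _ _ (lead_le h4)
  -- the degree of the commutator
  have hcd : (deg (v ξ * v o - v o * v ξ) : ℤ) = deg (v ξ) + groupDeg (lead η) := by
    rw [← groupDeg_lead_toSeries hd (sub_ne_zero.2 hcomm), map_sub, map_mul, map_mul, ← hF, ← hG]
    have h4 : (F * G - G * F) * (1 + t) = (1 + t) * (φ * η - η * φ) := by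
      have h5 : φ * η - η * φ = φ * (γ + η) - (γ + η) * φ := by
        rw [mul_add, add_mul, h3]
        abel
      rw [h5, commutator_conj h1 h2]
    rw [← (lead_of_conj ht h4 (sub_ne_zero.2 hFG)).2]
    rcases lead_commutator hφ0 hη0 (by rwa [hφl]) with h5 | h5
    · rw [h5, groupDeg_mul, hφl, hFd]
    · rw [h5, groupDeg_mul, hφl, hFd, add_comm]
  -- the degree of the value of `P`
  have hL := listCoeff_ne_zero hP
  have hval : (deg (FreeAlgebra.lift K v P) : ℤ) =
      groupDeg (lead (polyEval o φ (γ + η) (listCoeff P))) := by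
    have h4 := polyEval_conj o h1 h2 (listCoeff P)
    rw [← toSeries_lift h] at h4
    have h5 : FreeAlgebra.lift K v P ≠ 0 := by
      intro h6
      rw [h6, map_zero, zero_mul] at h4
      exact (lead_mul (one_add_ne_zero_and_lead ht).1 (D.polyEval_ne_zero h H hL).1).1 h4.symm
    rw [← groupDeg_lead_toSeries hd h5, (lead_of_conj ht h4 (toSeries_ne_zero h5)).2]
  obtain ⟨j, h4, h5⟩ := D.weight_le_lead h H hcase (P := listCoeff P)
    (W := wdeg (fun e => deg (v e)) P) (fun z hz => by
      rw [← sum_map_eq_wordWeight h fun e => deg (v e)]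
      exact Nat.cast_le.2 (le_wdeg (fun e => deg (v e)) (listCoeff_ne_zero_iff.1 hz))) (by
      obtain ⟨u, hu, h6⟩ := exists_wdeg_eq (fun e => deg (v e)) hP
      refine ⟨u.toList, listCoeff_ne_zero_iff.2 hu, ?_⟩
      rw [← sum_map_eq_wordWeight h fun e => deg (v e), h6])
  rw [← hval] at h5
  zify
  rw [hcd]
  have h6 := mul_le_mul_of_nonneg_right h4 (sub_nonneg.2 hδ)
  have h7 := mul_le_mul_of_nonneg_right h5
    (show (0 : ℤ) ≤ deg (v ξ) + deg (v o) by positivity)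
  linarith

end DegreeEstimate

section ReversedOrder

/-- The reverse of a degree order of the free group: a group order along which the degree
decreases. -/
theorem exists_linearOrder_antitone_groupDeg {X : Type*} [LinearOrder (FreeGroup X)]
    (hord : IsDegreeGroupOrder X) : ∃ L : LinearOrder (FreeGroup X),
      @MulLeftStrictMono (FreeGroup X) _ L.toLT ∧ @MulRightStrictMono (FreeGroup X) _ L.toLT ∧
      ∀ a b : FreeGroup X, L.le a b → groupDeg b ≤ groupDeg a := by
  refine ⟨OrderDual.instLinearOrder (FreeGroup X), ?_, ?_, ?_⟩
  · exact @CovariantClass.mk _ _ _ _ fun c a b h => hord.mul_lt_mul_left a b c h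
  · exact @CovariantClass.mk _ _ _ _ fun c a b h => hord.mul_lt_mul_right a b c h
  · intro a b h
    by_contra hlt
    exact absurd (hord.lt_of_groupDeg_lt _ _ (not_le.1 hlt)) (not_lt.2 h)

end ReversedOrder

/-! ### Monomials and homogeneous elements -/

section Independence

variable {K : Type*} [Field K]

theorem AlgIndep.mul_ne_mul {A : Type*} [Ring A] [Algebra K A] {f g : A} (h : AlgIndep K f g)
    (hne : FreeAlgebra.ι K (0 : Fin 2) * FreeAlgebra.ι K 1 ≠
      FreeAlgebra.ι K 1 * FreeAlgebra.ι K (0 : Fin 2)) : f * g ≠ g * f := by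
  intro hc
  apply hne
  apply h
  simpa [eval₂] using hc

theorem equiv_monomial {X : Type*} (u : FreeMonoid X) :
    FreeAlgebra.equivMonoidAlgebraFreeMonoid (monomial K u) = MonoidAlgebra.single u 1 := by
  induction u using FreeMonoid.inductionOn' with
  | one => simp [monomial, MonoidAlgebra.one_def]
  | of_mul x u ih =>
    rw [monomial, map_mul, map_mul]
    rw [monomial] at ih
    rw [ih]
    simp [FreeAlgebra.equivMonoidAlgebraFreeMonoid, MonoidAlgebra.single_mul_single]

theorem monomial_mul {X : Type*} (u v : FreeMonoid X) :
    monomial K (u * v) = monomial K u * monomial K v := by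
  simp [monomial]

theorem monomial_pow {X : Type*} (u : FreeMonoid X) (n : ℕ) :
    monomial K (u ^ n) = monomial K u ^ n := by
  simp [monomial]

theorem monomial_of {X : Type*} (x : X) : monomial K (FreeMonoid.of x) = FreeAlgebra.ι K x := by
  simp [monomial]

theorem monomial_injective {X : Type*} : Function.Injective (monomial K (X := X)) := by
  intro u v h
  have h1 := equiv_monomial (K := K) u
  rw [h, equiv_monomial, MonoidAlgebra.single_left_inj one_ne_zero] at h1
  exact h1.symm

theorem supp_monomial {X : Type*} (u : FreeMonoid X) : supp (monomial K u) = {u} := by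
  rw [supp, equiv_monomial, MonoidAlgebra.coeff_single, Finsupp.support_single _ one_ne_zero]

theorem supp_monomial_add {X : Type*} [DecidableEq (FreeMonoid X)] {u v : FreeMonoid X}
    (h : u ≠ v) : supp (monomial K u + monomial K v) = {u, v} := by
  rw [supp, map_add, MonoidAlgebra.coeff_add, equiv_monomial, equiv_monomial,
    MonoidAlgebra.coeff_single, MonoidAlgebra.coeff_single, Finsupp.support_add_eq,
    Finsupp.support_single _ one_ne_zero, Finsupp.support_single _ one_ne_zero]
  · rfl
  · rw [Finsupp.support_single _ one_ne_zero, Finsupp.support_single _ one_ne_zero]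
    simpa using h

theorem toList_of_pow {X : Type*} (x : X) (n : ℕ) :
    (FreeMonoid.of x ^ n).toList = List.replicate n x := by
  induction n with
  | zero => rfl
  | succ n ih =>
    rw [pow_succ', FreeMonoid.toList_mul, ih, List.replicate_succ]
    rfl

theorem pow_mul_of_ne {X : Type*} {x y : X} (h : x ≠ y) {n : ℕ} (hn : n ≠ 0) :
    FreeMonoid.of x ^ n * FreeMonoid.of y ≠ FreeMonoid.of y * FreeMonoid.of x ^ n := by
  obtain ⟨n, rfl⟩ := Nat.exists_eq_succ_of_ne_zero hn
  intro heq
  have h1 := congrArg FreeMonoid.toList heq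
  rw [pow_succ'] at h1
  simp only [FreeMonoid.toList_mul, FreeMonoid.toList_of, List.cons_append] at h1
  exact h (List.cons.inj h1).1

theorem ι_pow_mul_ne {X : Type*} {x y : X} (h : x ≠ y) {n : ℕ} (hn : n ≠ 0) :
    FreeAlgebra.ι K x ^ n * FreeAlgebra.ι K y ≠ FreeAlgebra.ι K y * FreeAlgebra.ι K x ^ n := by
  rw [← monomial_of, ← monomial_of, ← monomial_pow, ← monomial_mul, ← monomial_mul]
  exact fun heq => pow_mul_of_ne h hn (monomial_injective heq)

theorem ι_mul_ne {X : Type*} {x y : X} (h : x ≠ y) :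
    FreeAlgebra.ι K x * FreeAlgebra.ι K y ≠ FreeAlgebra.ι K y * FreeAlgebra.ι K x := by
  simpa using ι_pow_mul_ne (K := K) h one_ne_zero

end Independence

section Homogeneous

variable {K X : Type*} [Field K]

/-- All words of `f` have weight `N`. -/
def IsHomog (w : X → ℕ) (f : FreeAlgebra K X) (N : ℕ) : Prop :=
  ∀ u ∈ supp f, (u.toList.map w).sum = N

variable {w : X → ℕ} {f g : FreeAlgebra K X} {N M : ℕ}

theorem IsHomog.wdeg_eq (h : IsHomog w f N) (hf : f ≠ 0) : wdeg w f = N := by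
  obtain ⟨u, hu, h1⟩ := exists_wdeg_eq w hf
  rw [← h1, h u hu]

theorem isHomog_monomial (w : X → ℕ) (u : FreeMonoid X) :
    IsHomog w (monomial K u) (u.toList.map w).sum := by
  intro v hv
  rw [supp_monomial, Finset.mem_singleton] at hv
  rw [hv]

theorem isHomog_ι (w : X → ℕ) (x : X) : IsHomog w (FreeAlgebra.ι K x) (w x) := by
  simpa [monomial_of] using isHomog_monomial (K := K) w (FreeMonoid.of x)

theorem IsHomog.sub (hf : IsHomog w f N) (hg : IsHomog w g N) : IsHomog w (f - g) N := by
  intro u hu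
  rw [mem_supp, map_sub, MonoidAlgebra.coeff_sub, Finsupp.sub_apply] at hu
  by_cases h : u ∈ supp f
  · exact hf u h
  · refine hg u (mem_supp.2 fun h' => hu ?_)
    rw [mem_supp, not_not] at h
    rw [h, h', sub_zero]

theorem IsHomog.mul (hf : IsHomog w f N) (hg : IsHomog w g M) : IsHomog w (f * g) (N + M) := by
  classical
  intro u hu
  rw [supp, map_mul] at hu
  obtain ⟨a, ha, b, hb, rfl⟩ := Finset.mem_mul.1 (MonoidAlgebra.support_coeff_mul_subset _ _ hu)
  rw [FreeMonoid.toList_mul, List.map_append, List.sum_append, hf a ha, hg b hb]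

theorem IsHomog.pow (hf : IsHomog w f N) (r : ℕ) : IsHomog w (f ^ r) (r * N) := by
  induction r with
  | zero => simpa [monomial] using isHomog_monomial (K := K) w 1
  | succ r ih =>
    rw [pow_succ, Nat.succ_mul]
    exact ih.mul hf

end Homogeneous

/-! ### The pair `x ^ n`, `x ^ m + y` -/

section SharpExample

variable {K X : Type*} [Field K]

theorem lead_single {Γ : Type*} [LinearOrder Γ] [Group Γ] (a : Γ) :
    HahnSeries.single a (1 : K) ≠ 0 ∧ lead (HahnSeries.single a (1 : K)) = a := by
  have h : (HahnSeries.single a (1 : K)).coeff a ≠ 0 := by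
    rw [HahnSeries.coeff_single_same]; exact one_ne_zero
  exact ⟨ne_zero_of_coeff h, lead_eq_of h fun g hg => HahnSeries.coeff_single_of_ne hg.ne⟩

/-- The elements `x ^ n` and `x ^ m + y` are algebraically independent: the exponent of `y` does not
commute with that of `x ^ n`, so the expansion of `P(φ, γ + η)` applies to them as they are. -/
theorem algIndep_pow_pow_add [LinearOrder (FreeGroup X)] [MulLeftStrictMono (FreeGroup X)]
    [MulRightStrictMono (FreeGroup X)]
    (hd : ∀ a b : FreeGroup X, a ≤ b → groupDeg b ≤ groupDeg a) {i j : X}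
    (hij : i ≠ j) {n m : ℕ} (hn : n ≠ 0) (hm : m ≠ 0) :
    AlgIndep K (FreeAlgebra.ι K i ^ n) (FreeAlgebra.ι K i ^ m + FreeAlgebra.ι K j) := by
  have hS : ∀ u : FreeMonoid X, toSeries (monomial K u) = HahnSeries.single (toFreeGroup u) 1 := by
    intro u
    rw [toSeries_eq_sum, supp_monomial, Finset.sum_singleton, equiv_monomial]
    simp
  set a : FreeGroup X := toFreeGroup (FreeMonoid.of i ^ n) with ha
  set b : FreeGroup X := toFreeGroup (FreeMonoid.of i ^ m) with hb
  set c : FreeGroup X := toFreeGroup (FreeMonoid.of j) with hc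
  have hab : a * b = b * a := by
    rw [ha, hb, ← toFreeGroup_mul, ← toFreeGroup_mul, ← pow_add, ← pow_add, add_comm]
  have hac : a * c ≠ c * a := by
    rw [ha, hc, ← toFreeGroup_mul, ← toFreeGroup_mul]
    exact fun h => pow_mul_of_ne hij hn (toFreeGroup_injective h)
  have hsupp : ∀ {g : FreeGroup X}, a * g = g * a →
      (HahnSeries.single g (1 : K)).support ⊆ Subgroup.centralizer {a} := by
    intro g hg g' hg'
    obtain rfl : g' = g := by
      by_contra hne
      exact hg' (HahnSeries.coeff_single_of_ne hne)
    refine Subgroup.mem_centralizer_iff.2 ?_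
    rintro _ rfl
    exact hg
  have H : FreeOver (Subgroup.centralizer {a}) (HahnSeries.single a (1 : K))
      (HahnSeries.single b 1) (HahnSeries.single c 1) :=
    freeOver_centralizer (hsupp rfl) (hsupp hab) (lead_single c).1 (by rwa [(lead_single c).2])
  have hdeg : ∀ (x : X) (l : ℕ), groupDeg (toFreeGroup (FreeMonoid.of x ^ l)) = l := by
    intro x l
    rw [groupDeg_toFreeGroup, toList_of_pow]
    simp
  have D : DegreeData groupDeg (HahnSeries.single a (1 : K)) (HahnSeries.single b 1) n m := {
    map_mul := groupDeg_mul
    antitone := hd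
    ne_zero := (lead_single a).1
    lead_eq := by rw [(lead_single a).2, ha, hdeg]
    pos_left := by omega
    pos_right := by omega
    le_of_coeff := by
      intro g hg
      obtain rfl : g = b := by
        by_contra hne
        exact hg (HahnSeries.coeff_single_of_ne hne)
      exact (hdeg i m).le }
  intro P Q hPQ
  by_contra hne
  refine (D.polyEval_ne_zero (o := 1) (zero_ne_one (α := Fin 2)) H
    (listCoeff_ne_zero (sub_ne_zero.2 hne))).1 ?_
  have h1 := toSeries_lift (zero_ne_one (α := Fin 2))
    ![FreeAlgebra.ι K i ^ n, FreeAlgebra.ι K i ^ m + FreeAlgebra.ι K j] (P - Q)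
  have h2 : FreeAlgebra.lift K ![FreeAlgebra.ι K i ^ n,
      FreeAlgebra.ι K i ^ m + FreeAlgebra.ι K j] (P - Q) = 0 := by
    rw [map_sub]
    exact sub_eq_zero.2 hPQ
  rw [h2, map_zero] at h1
  rw [h1]
  simp only [Matrix.cons_val_zero, Matrix.cons_val_one, map_add]
  rw [← monomial_of, ← monomial_of, ← monomial_pow, ← monomial_pow, hS, hS, hS]

theorem deg_pow_add {i j : X} (hij : i ≠ j) {m : ℕ} (hm : m ≠ 0) :
    deg (FreeAlgebra.ι K i ^ m + FreeAlgebra.ι K j) = m := by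
  classical
  have hne : FreeMonoid.of i ^ m ≠ FreeMonoid.of j := by
    intro h
    have := pow_mul_of_ne hij hm
    rw [h] at this
    exact this rfl
  rw [← monomial_of, ← monomial_of, ← monomial_pow, deg, wdeg, supp_monomial_add hne,
    Finset.sup_insert, Finset.sup_singleton, toList_of_pow]
  simp
  omega

/-- `x ^ m` is the leading monomial of `x ^ m + y`. -/
theorem isLeadingMonomial_pow_add [LinearOrder (FreeGroup X)] (hord : IsDegreeGroupOrder X)
    {i j : X} (hij : i ≠ j) {m : ℕ} (hm : 2 ≤ m) :
    IsLeadingMonomial (FreeAlgebra.ι K i ^ m + FreeAlgebra.ι K j) (FreeMonoid.of i ^ m) := by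
  classical
  have hne : FreeMonoid.of i ^ m ≠ FreeMonoid.of j := by
    intro h
    have := pow_mul_of_ne hij (n := m) (by omega)
    rw [h] at this
    exact this rfl
  rw [← monomial_of, ← monomial_of, ← monomial_pow, IsLeadingMonomial, supp_monomial_add hne]
  refine ⟨by simp, fun v hv => ?_⟩
  rw [Finset.mem_insert, Finset.mem_singleton] at hv
  rcases hv with rfl | rfl
  · exact le_rfl
  · refine (hord.lt_of_groupDeg_lt _ _ ?_).le
    rw [groupDeg_toFreeGroup, groupDeg_toFreeGroup, toList_of_pow]
    simp
    omega

theorem isLeadingMonomial_monomial [LinearOrder (FreeGroup X)] (u : FreeMonoid X) :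
    IsLeadingMonomial (monomial K u) u := by
  rw [IsLeadingMonomial, supp_monomial]
  exact ⟨Finset.mem_singleton_self u, fun v hv => by rw [Finset.mem_singleton.1 hv]⟩

theorem admissible_pow_pow_add [LinearOrder (FreeGroup X)] (hord : IsDegreeGroupOrder X) {i j : X}
    (hij : i ≠ j) {n m : ℕ} (hn : n ≠ 0) (hm : 2 ≤ m) (hnm : ¬ n ∣ m) (hmn : ¬ m ∣ n) :
    Admissible (FreeAlgebra.ι K i ^ n) (FreeAlgebra.ι K i ^ m + FreeAlgebra.ι K j) := by
  have hf : deg (FreeAlgebra.ι K i ^ n) = n := by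
    rw [deg, ((isHomog_ι _ i).pow n).wdeg_eq (pow_ne_zero _ (FreeAlgebra.ι_ne_zero i)), mul_one]
  have hind : AlgIndep K (FreeAlgebra.ι K i ^ n) (FreeAlgebra.ι K i ^ m + FreeAlgebra.ι K j) := by
    obtain ⟨L, hl, hr, hd⟩ := exists_linearOrder_antitone_groupDeg hord
    exact @algIndep_pow_pow_add K X _ L hl hr hd i j hij n m hn (by omega)
  refine ⟨hind,
    ⟨FreeMonoid.of i ^ n, FreeMonoid.of i ^ m, ?_, isLeadingMonomial_pow_add hord hij hm, ?_⟩,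
    by rwa [hf, deg_pow_add hij (by omega)], by rwa [hf, deg_pow_add hij (by omega)]⟩
  · rw [← monomial_of, ← monomial_pow]
    exact isLeadingMonomial_monomial _
  · intro h
    refine h.mul_ne_mul (ι_mul_ne zero_ne_one) ?_
    rw [← monomial_mul, ← monomial_mul, ← pow_add, ← pow_add, add_comm]

end SharpExample

/-! ### The bound and its sharpness -/

section Conclusion

variable {K X : Type*} [Field K]

theorem wdeg_mul_deg_commutator_le_of_not_dvd [LinearOrder (FreeGroup X)]
    [MulLeftStrictMono (FreeGroup X)] [MulRightStrictMono (FreeGroup X)]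
    (hd : ∀ a b : FreeGroup X, a ≤ b → groupDeg b ≤ groupDeg a) {f g : FreeAlgebra K X}
    (hfg : f * g ≠ g * f) (hdvd : ¬ deg f ∣ deg g) (hdvd' : ¬ deg g ∣ deg f)
    {P : FreeAlgebra K (Fin 2)} (hP : P ≠ 0) :
    wdeg ![deg f, deg g] P * deg (f * g - g * f) ≤ deg (eval₂ f g P) * (deg f + deg g) := by
  have hw : (fun e => deg (![f, g] e)) = ![deg f, deg g] := by
    ext e
    fin_cases e <;> rfl
  have hf : 0 < deg f := Nat.pos_of_ne_zero fun h0 => hdvd' (h0 ▸ dvd_zero _)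
  have hg : 0 < deg g := Nat.pos_of_ne_zero fun h0 => hdvd (h0 ▸ dvd_zero _)
  rcases le_total (deg f) (deg g) with hle | hle
  · have := wdeg_mul_deg_commutator_le hd zero_ne_one (v := ![f, g]) hf hle hdvd hfg hP
    rw [hw] at this
    exact this
  · have := wdeg_mul_deg_commutator_le hd one_ne_zero (v := ![f, g]) hg hle hdvd' hfg.symm hP
    rw [hw] at this
    have h1 : deg (f * g - g * f) = deg (g * f - f * g) := by rw [← deg_neg, neg_sub]
    rw [h1, add_comm]
    exact this

theorem Admissible.wdeg_mul_deg_commutator_le [LinearOrder (FreeGroup X)]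
    (hord : IsDegreeGroupOrder X) {f g : FreeAlgebra K X} (h : Admissible f g)
    {P : FreeAlgebra K (Fin 2)} (hP : P ≠ 0) :
    wdeg ![deg f, deg g] P * deg (f * g - g * f) ≤ deg (eval₂ f g P) * (deg f + deg g) := by
  have hfg := h.algIndep.mul_ne_mul (ι_mul_ne zero_ne_one)
  have h1 := h.not_dvd
  have h2 := h.not_dvd'
  obtain ⟨L, hl, hr, hd⟩ := exists_linearOrder_antitone_groupDeg hord
  exact @wdeg_mul_deg_commutator_le_of_not_dvd K X _ L hl hr hd f g hfg h1 h2 P hP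

/-- The degrees entering the estimate for `x ^ n`, `x ^ m + y` and the power `[x, y] ^ r`. -/
theorem degrees_of_commutator_pow {i j : X} (hij : i ≠ j) {n : ℕ} (hn : n ≠ 0) (m r : ℕ) :
    deg (FreeAlgebra.ι K i ^ n * (FreeAlgebra.ι K i ^ m + FreeAlgebra.ι K j) -
      (FreeAlgebra.ι K i ^ m + FreeAlgebra.ι K j) * FreeAlgebra.ι K i ^ n) = n + 1 ∧
    deg (eval₂ (FreeAlgebra.ι K i ^ n) (FreeAlgebra.ι K i ^ m + FreeAlgebra.ι K j)
      ((FreeAlgebra.ι K 0 * FreeAlgebra.ι K 1 - FreeAlgebra.ι K 1 * FreeAlgebra.ι K 0) ^ r)) =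
        r * (n + 1) ∧
    wdeg ![n, m] ((FreeAlgebra.ι K (0 : Fin 2) * FreeAlgebra.ι K 1 -
      FreeAlgebra.ι K 1 * FreeAlgebra.ι K 0) ^ r) = r * (n + m) := by
  have hc : FreeAlgebra.ι K i ^ n * (FreeAlgebra.ι K i ^ m + FreeAlgebra.ι K j) -
      (FreeAlgebra.ι K i ^ m + FreeAlgebra.ι K j) * FreeAlgebra.ι K i ^ n =
      FreeAlgebra.ι K i ^ n * FreeAlgebra.ι K j - FreeAlgebra.ι K j * FreeAlgebra.ι K i ^ n := by
    rw [mul_add, add_mul, ← pow_add, ← pow_add, add_comm m n]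
    abel
  have h0 : FreeAlgebra.ι K i ^ n * FreeAlgebra.ι K j -
      FreeAlgebra.ι K j * FreeAlgebra.ι K i ^ n ≠ 0 := sub_ne_zero.2 (ι_pow_mul_ne hij hn)
  have h1 : IsHomog (fun _ => 1) (FreeAlgebra.ι K i ^ n * FreeAlgebra.ι K j -
      FreeAlgebra.ι K j * FreeAlgebra.ι K i ^ n) (n + 1) := by
    have hx := (isHomog_ι (K := K) (fun _ => 1) i).pow n
    have hy := isHomog_ι (K := K) (fun _ => 1) j
    rw [mul_one] at hx
    have := hy.mul hx
    rw [add_comm] at this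
    exact (hx.mul hy).sub this
  have h2 : IsHomog ![n, m] (FreeAlgebra.ι K (0 : Fin 2) * FreeAlgebra.ι K 1 -
      FreeAlgebra.ι K 1 * FreeAlgebra.ι K 0) (n + m) := by
    have hx : IsHomog ![n, m] (FreeAlgebra.ι K (0 : Fin 2)) n := isHomog_ι _ 0
    have hy : IsHomog ![n, m] (FreeAlgebra.ι K (1 : Fin 2)) m := isHomog_ι _ 1
    have := hy.mul hx
    rw [add_comm] at this
    exact (hx.mul hy).sub this
  refine ⟨?_, ?_, (h2.pow r).wdeg_eq (pow_ne_zero r (sub_ne_zero.2 (ι_mul_ne zero_ne_one)))⟩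
  · rw [hc]
    exact h1.wdeg_eq h0
  · rw [eval₂, map_pow, map_sub, map_mul, map_mul, FreeAlgebra.lift_ι_apply,
      FreeAlgebra.lift_ι_apply]
    simp only [Matrix.cons_val_zero, Matrix.cons_val_one]
    rw [hc]
    exact (h1.pow r).wdeg_eq (pow_ne_zero r h0)

theorem commutator_pow_notMem_range {r : ℕ} (hr : 1 ≤ r) :
    (FreeAlgebra.ι K (0 : Fin 2) * FreeAlgebra.ι K 1 - FreeAlgebra.ι K 1 * FreeAlgebra.ι K 0) ^ r ∉
      Set.range (algebraMap K (FreeAlgebra K (Fin 2))) := by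
  rintro ⟨s, hs⟩
  -- the constant term of the commutator vanishes
  have h1 := congrArg FreeAlgebra.algebraMapInv hs
  rw [FreeAlgebra.algebraMap_leftInverse s, map_pow, map_sub, map_mul, map_mul] at h1
  rw [mul_comm (FreeAlgebra.algebraMapInv (FreeAlgebra.ι K (0 : Fin 2))), sub_self,
    zero_pow (by omega)] at h1
  rw [h1, map_zero] at hs
  exact pow_ne_zero r (sub_ne_zero.2 (ι_mul_ne zero_ne_one)) hs.symm

end Conclusion

end FreeDeg

theorem theorem1p1 {K : Type*} [Field K] (k : ℕ) [LinearOrder (FreeGroup (Fin k))]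
    (hord : FreeDeg.IsDegreeGroupOrder (Fin k)) :
    (∀ f g : FreeAlgebra K (Fin k), FreeDeg.Admissible f g →
      ∀ P : FreeAlgebra K (Fin 2), P ∉ Set.range (algebraMap K (FreeAlgebra K (Fin 2))) →
        (FreeDeg.deg (FreeDeg.eval₂ f g P) : ℝ) ≥
          (FreeDeg.wdeg ![FreeDeg.deg f, FreeDeg.deg g] P : ℝ) *
            ((FreeDeg.deg (f * g - g * f) : ℝ) / ((FreeDeg.deg f : ℝ) + (FreeDeg.deg g : ℝ)))) ∧
    -- sharpness: for `f = x ^ n`, `g = x ^ m + y` and `P = [x, y] ^ r` equality holds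
    (∀ i j : Fin k, i ≠ j → ∀ n m r : ℕ, ¬ n ∣ m → ¬ m ∣ n → 1 ≤ r →
      ∀ f g : FreeAlgebra K (Fin k), f = FreeAlgebra.ι K i ^ n →
        g = FreeAlgebra.ι K i ^ m + FreeAlgebra.ι K j →
      ∀ P : FreeAlgebra K (Fin 2),
        P = (FreeAlgebra.ι K 0 * FreeAlgebra.ι K 1 - FreeAlgebra.ι K 1 * FreeAlgebra.ι K 0) ^ r →
        FreeDeg.Admissible f g ∧
        P ∉ Set.range (algebraMap K (FreeAlgebra K (Fin 2))) ∧
        (FreeDeg.deg (FreeDeg.eval₂ f g P) : ℝ) =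
          (FreeDeg.wdeg ![FreeDeg.deg f, FreeDeg.deg g] P : ℝ) *
            ((FreeDeg.deg (f * g - g * f) : ℝ) / ((FreeDeg.deg f : ℝ) + (FreeDeg.deg g : ℝ)))) := by
  refine ⟨fun f g h P hP => ?_, ?_⟩
  · have hP0 : P ≠ 0 := by
      rintro rfl
      exact hP ⟨0, map_zero _⟩
    have h1 : 0 < FreeDeg.deg f := Nat.pos_of_ne_zero fun h0 => h.not_dvd' (h0 ▸ dvd_zero _)
    have h2 : (0 : ℝ) < (FreeDeg.deg f : ℝ) + (FreeDeg.deg g : ℝ) := by positivity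
    rw [ge_iff_le, ← mul_div_assoc, div_le_iff₀ h2]
    exact_mod_cast h.wdeg_mul_deg_commutator_le hord hP0
  · rintro i j hij n m r hnm hmn hr f g rfl rfl P rfl
    have hn : n ≠ 0 := by
      rintro rfl
      exact hmn (dvd_zero m)
    have hm : 2 ≤ m := by
      by_contra hm
      obtain rfl | rfl : m = 0 ∨ m = 1 := by omega
      · exact hnm (dvd_zero n)
      · exact hmn (one_dvd n)
    refine ⟨FreeDeg.admissible_pow_pow_add hord hij hn hm hnm hmn,
      FreeDeg.commutator_pow_notMem_range hr, ?_⟩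
    have hf : FreeDeg.deg (FreeAlgebra.ι K i ^ n) = n := by
      rw [FreeDeg.deg, ((FreeDeg.isHomog_ι _ i).pow n).wdeg_eq
        (pow_ne_zero _ (FreeAlgebra.ι_ne_zero i)), mul_one]
    obtain ⟨h1, h2, h3⟩ := FreeDeg.degrees_of_commutator_pow (K := K) hij hn m r
    rw [hf, FreeDeg.deg_pow_add hij (by omega), h1, h2, h3]
    have h4 : (n : ℝ) + m ≠ 0 := by positivity
    push_cast
    field_simp
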